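/- **Nets.** A *priced timed Petri net* (PTPN) $\mathcal N=(Q,P,T,\mathrm{Cost})$ has a finite set $Q$ of control states, a finite set $P$ of places, a finite set $T$ of transitions $t=(q_1,q_2,\mathrm{In},\mathrm{Read},\mathrm{Out})$, where $q_1,q_2\in Q$ and $\mathrm{In},\mathrm{Read},\mathrm{Out}$ are finite multisets of pairs of a place and an interval (open or closed on either side, lower bound in $\mathbb N$, upper bound in $\mathbb N\cup\{\infty\}$), and a cost function $\mathrm{Cost}:P\cup T\to\mathbb N$. Let $c_{\max}$ be the largest integer on the arcs ($0$ if there is none). A marking $M$ is a finite multiset over $P\times\mathbb R_{\ge0}$ (tokens with ages); $M^{+x}$ is $M$ with all ages increased by $x$. For a multiset $M$ of tokens and a multiset $\alpha$ of arcs, $\mathrm{match}(M,\alpha)$ means that there is a bijection from $M$ to $\alpha$ sending each $(p,x)$ to some $(p,J)$ with $x\in J$. The steps between configurations $(q,M)$ are: - $(q,M)\to(q,M^{+x})$ for real $x>0$, of cost $x\sum_{p}|M(p)|\,\mathrm{Cost}(p)$; - $(q_1,I+R+M')\to(q_2,O+R+M')$ of cost $\mathrm{Cost}(t)$, for $t=(q_1,q_2,\mathrm{In},\mathrm{Read},\mathrm{Out})\in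 T$ and $\mathrm{match}(I,\mathrm{In})$, $\mathrm{match}(R,\mathrm{Read})$, $\mathrm{match}(O,\mathrm{Out})$. A computation is a finite sequence of steps, possibly empty; its cost is the sum of the costs of its steps. **The abstract net (A-PTPN).** Its configurations are $(q,b_{-m}\dots b_{-1},b_0,b_1\dots b_n)$ with $q\in Q$ and finite multisets $b_i$ over $P\times\{0,\dots,c_{\max}+1\}$, where the $b_i$ with $i\ne0$ are nonempty and $b_0$ may be empty. Whenever the rules below produce an empty multiset as a member of one of the two words, it is deleted. Let $b^{+\epsilon}$ be $b$ with all ages increased by the real number $\epsilon$, and let $b^+$ be $b$ with every age $a$ replaced by $\min(a+1,c_{\max}+1)$. The steps are: - *Discrete*, of cost $\mathrm{Cost}(t)$, for $t=(q_1,q_2,\mathrm{In},\mathrm{Read},\mathrm{Out})\in T$: $(q_1,b_{-m}\dots b_{-1},b_0,b_1\dots b_n)\to(q_2,c_{-m'}\dots c_{-1},c_0,c_1\dots c_{n'})$ if there are decompositions $b_i=b_i^I+b_i^R+b_i^{rest}$ and multisets $\hat O,b_0^O$ such that for all $0<\epsilon<1$ one has $\mathrm{match}((\sum_{i\ne0}b_i^I)^{+\epsilon}+b_0^I,\mathrm{In})$,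 $\mathrm{match}((\sum_{i\ne0}b_i^R)^{+\epsilon}+b_0^R,\mathrm{Read})$ and $\mathrm{match}(\hat O^{+\epsilon}+b_0^O,\mathrm{Out})$, and there is a strictly increasing injection $f:\{-m,\dots,n\}\to\{-m',\dots,n'\}$ with $f(0)=0$, $c_{f(i)}\ge b_i-b_i^I$, $c_0=b_0-b_0^I+b_0^O$ and $\sum_{i\ne0}c_i=\sum_{i\ne0}(b_i-b_i^I)+\hat O$ (the $c_i$ may be empty here; the empty ones with $i\neq 0$ are then deleted). - *Type 1*, of cost $0$: $(q,b_{-m}\dots b_{-1},b_0,b_1\dots b_n)\to(q,b_{-m}\dots b_{-1},\emptyset,b_0b_1\dots b_n)$. - *Type 2*, of cost $0$, for $m\ge1$: $(q,b_{-m}\dots b_{-1},\emptyset,b_1\dots b_n)\to(q,b_{-m}\dots b_{-2},b_{-1}^+,b_1\dots b_n)$. - *Type 3*, for $0\le k\le n$: $(q,b_{-m}\dots b_{-1},b_0,b_1\dots b_n)\to(q,b_{-m}^+\dots b_{-1}^+b_0\dots b_k,\emptyset,b_{k+1}^+\dots b_n^+)$. - *Type 4*, for $0\le k\le n-1$: $(q,b_{-m}\dots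 b_{-1},b_0,b_1\dots b_n)\to(q,b_{-m}^+\dots b_{-1}^+b_0\dots b_k,b_{k+1}^+,b_{k+2}^+\dots b_n^+)$. A step of type 3 or 4 costs $\sum_i\sum_{p}|b_i(p)|\,\mathrm{Cost}(p)$ (computed in its source configuration). **Abstraction map.** For a marking $M$ group the tokens by the fractional part of their ages, and replace each age $x$ by $\min(\lfloor x\rfloor,c_{\max}+1)$. Then $\mathrm{aptpn}(q,M)=(q,b_{-m}\dots b_{-1},b_0,b_1\dots b_n)$, where $b_0$ is the group with fractional part $0$, $b_{-m}\dots b_{-1}$ are the groups with fractional part at least $1/2$, and $b_1\dots b_n$ the groups with fractional part in $(0,1/2)$, both in increasing order of the fractional part. For a set $C$ of configurations, $\mathrm{aptpn}(C)$ is the set of all $\mathrm{aptpn}(q,M)$ with $(q,M)\in C$ such that all ages in $M$ have fractional part $<2/5$ or $>3/5$. **Theorem.** Let $\mathcal N$ be a PTPN, $q_{init},q_{fin}\in Q$, $c_{init}=(q_{init},\emptyset)$, and let $C_{fin}$ be the set of all configurations with control state $q_{fin}$. Then $$\inf\{\mathrm{Cost}(\pi)\mid \pi \text{ a computation of } \mathcal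 N \text{ from } c_{init} \text{ to } C_{fin}\}=\inf\{\mathrm{Cost}(\pi')\mid \pi' \text{ a computation of the A-PTPN from } \mathrm{aptpn}(c_{init}) \text{ to } \mathrm{aptpn}(C_{fin})\},$$ where both infima are taken in $[0,\infty]$ and the infimum of the empty set is $\infty$. -/

import Mathlib

open scoped NNReal ENNReal

noncomputable section

namespace PTPNCost

/-! ## Computations of a transition system whose steps carry costs -/

/-- `Comp step c r c'`: there is a finite (possibly empty) sequence of steps from `c` to `c'`
whose costs add up to `r`. -/
inductive Comp {C : Type*} (step : C → ℝ≥0 → C → Prop) : C → ℝ≥0 → C → Prop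
  | refl (c : C) : Comp step c 0 c
  | cons {c d e : C} {r s : ℝ≥0} (h : step c r d) (hs : Comp step d s e) :
      Comp step c (r + s) e

/-- The infimum in `[0, ∞]` of the costs of all computations that lead from a configuration in `S`
to a configuration in `S'` (it is `∞` if there are none). -/
def optCost {C : Type*} (step : C → ℝ≥0 → C → Prop) (S S' : Set C) : ℝ≥0∞ :=
  sInf {v : ℝ≥0∞ | ∃ c ∈ S, ∃ c' ∈ S', ∃ r : ℝ≥0, Comp step c r c' ∧ v = (r : ℝ≥0∞)}

/-! ## Priced timed Petri nets -/

/-- An interval of ages, open or closed on either side, with a lower bound in `ℕ` and an upper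
bound in `ℕ ∪ {∞}`. -/
structure Intrv where
  lower : ℕ
  upper : ℕ∞
  lowerClosed : Bool
  upperClosed : Bool

/-- Membership of an age in an interval. An infinite upper bound is no constraint. -/
def Intrv.Contains (J : Intrv) (x : ℝ≥0) : Prop :=
  (if J.lowerClosed then (J.lower : ℝ≥0) ≤ x else (J.lower : ℝ≥0) < x) ∧
  ∀ z : ℕ, J.upper = (z : ℕ∞) → if J.upperClosed then x ≤ (z : ℝ≥0) else x < (z : ℝ≥0)

/-- The largest integer among the bounds of the interval. -/
def Intrv.maxBound (J : Intrv) : ℕ := max J.lower J.upper.toNat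

/-- A transition: source and target control state, and the multisets of input arcs, read arcs and
output arcs. -/
structure Transition (Q P : Type*) where
  source : Q
  target : Q
  inputs : Multiset (P × Intrv)
  reads : Multiset (P × Intrv)
  outputs : Multiset (P × Intrv)

/-- A priced timed Petri net with control states `Q` and places `P` (both are required to be finite
where nets are used). -/
structure PTPN (Q P : Type*) where
  transitions : Finset (Transition Q P)
  placeCost : P → ℕ
  transCost : {t // t ∈ transitions} → ℕ

/-- A marking: a finite multiset of tokens, that is of pairs of a place and an age. -/
abbrev Marking (P : Type*) := Multiset (P × ℝ≥0)

/-- The marking in which every token has become older by `x`. -/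
def delay {P : Type*} (x : ℝ≥0) (M : Marking P) : Marking P :=
  M.map fun a => (a.1, a.2 + x)

/-- A bijection between the tokens and the arcs (with multiplicities) such that matched tokens and
arcs have the same place and the age of the token lies in the interval of the arc. -/
def Match {P : Type*} (M : Marking P) (arcs : Multiset (P × Intrv)) : Prop :=
  Multiset.Rel (fun a b => a.1 = b.1 ∧ b.2.Contains a.2) M arcs

namespace PTPN

variable {Q P : Type*} (N : PTPN Q P)

/-- The maximal integer on the arcs of the net (`0` if there is none). -/
def cmax : ℕ :=
  N.transitions.sup fun t => ((t.inputs + t.reads + t.outputs).map fun a => a.2.maxBound).sup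

/-- The cost of storing the given tokens for one unit of time: the sum over the tokens of the costs
of their places, that is `∑ p, |M(p)| * Cost(p)`. -/
def storageCost {A : Type*} (M : Multiset (P × A)) : ℕ :=
  (M.map fun a => N.placeCost a.1).sum

/-- The transitions of the net between its configurations, together with their costs. -/
inductive Step : Q × Marking P → ℝ≥0 → Q × Marking P → Prop
  | time (q : Q) (M : Marking P) (x : ℝ≥0) (hx : 0 < x) :
      Step (q, M) (x * (N.storageCost M : ℝ≥0)) (q, delay x M)
  | disc (t : {t // t ∈ N.transitions}) (I R O rest : Marking P)
      (hI : Match I t.1.inputs) (hR : Match R t.1.reads) (hO : Match O t.1.outputs) :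
      Step (t.1.source, I + R + rest) (N.transCost t : ℝ≥0) (t.1.target, O + R + rest)

end PTPN

/-- The initial configuration: the control state `q` and no tokens. -/
def initConf {Q : Type*} (P : Type*) (q : Q) : Q × Marking P := (q, 0)

/-- The final configurations: all configurations with control state `q`. -/
def finConfs {Q : Type*} (P : Type*) (q : Q) : Set (Q × Marking P) := {c | c.1 = q}

/-! ## Abstract markings -/

/-- Finite multisets of tokens with an age in `{0, …, K + 1}`. -/
abbrev ATokens (P : Type*) (K : ℕ) := Multiset (P × Fin (K + 2))

/-- An abstract marking: `high` is the word `b₋ₘ … b₋₁`, `zero` is `b₀` and `low` is the word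
`b₁ … bₙ`. -/
structure AMarking (P : Type*) (K : ℕ) where
  high : List (ATokens P K)
  zero : ATokens P K
  low : List (ATokens P K)

/-- The age `n` in `{0, …, K + 1}`, where `K + 1` stands for all larger ages. -/
def cutAge (K n : ℕ) : Fin (K + 2) := ⟨min n (K + 1), by omega⟩

section AMarking

variable {P : Type*} {K : ℕ}

/-- The multiset `b⁺`: all ages are increased by one, and `K + 1` stays `K + 1`. -/
def succAge (b : ATokens P K) : ATokens P K :=
  b.map fun a => (a.1, cutAge K ((a.2 : ℕ) + 1))

/-- The tokens of `b` with their ages increased by the real number `e`. -/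
def shift (e : ℝ≥0) (b : ATokens P K) : Marking P :=
  b.map fun a => (a.1, ((a.2 : ℕ) : ℝ≥0) + e)

open Classical in
/-- The word that is left when the empty multisets are deleted from `w`. The words in an abstract
marking are sequences of nonempty multisets. -/
def reduce (w : List (ATokens P K)) : List (ATokens P K) := w.filter fun b => b ≠ 0

/-- All tokens of an abstract marking. -/
def AMarking.tokens (B : AMarking P K) : ATokens P K := B.high.sum + B.zero + B.low.sum

/-- The multisets `bᵢ` with `i ≠ 0` are nonempty. -/
def AMarking.Reduced (B : AMarking P K) : Prop :=
  (∀ b ∈ B.high, b ≠ 0) ∧ (∀ b ∈ B.low, b ≠ 0)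

/-- The tokens of `M` with fractional part `f`, with the integral parts of their ages. -/
def fracPart (K : ℕ) (M : Marking P) (f : ℝ) : ATokens P K :=
  (M.filter fun a => Int.fract (a.2 : ℝ) = f).map fun a => (a.1, cutAge K ⌊(a.2 : ℝ)⌋₊)

/-- The set of fractional parts of the ages in `M`. -/
def fracs (M : Marking P) : Finset ℝ := (M.map fun a => Int.fract (a.2 : ℝ)).toFinset

/-- The abstraction of a marking: the tokens are grouped by the fractional part of their ages, the
groups with fractional part at least `1/2` form the word `high` and those with fractional part in
`(0, 1/2)` the word `low`, both in increasing order. -/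
def absMarking (K : ℕ) (M : Marking P) : AMarking P K where
  high := (((fracs M).filter fun f => 1 / 2 ≤ f).sort (· ≤ ·)).map (fracPart K M)
  zero := fracPart K M 0
  low := (((fracs M).filter fun f => 0 < f ∧ f < 1 / 2).sort (· ≤ ·)).map (fracPart K M)

/-- Every age is at distance less than `δ` from an integer. -/
def InDeltaForm (δ : ℝ) (M : Marking P) : Prop :=
  ∀ a ∈ M, Int.fract (a.2 : ℝ) < δ ∨ 1 - δ < Int.fract (a.2 : ℝ)

/-- A decomposition of one multiset `bᵢ` into the tokens that are consumed, the tokens that are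
read, and the rest. -/
structure Split (P : Type*) (K : ℕ) where
  inp : ATokens P K
  read : ATokens P K
  rest : ATokens P K

/-- The decomposed multiset `bᵢ`. -/
def Split.total (s : Split P K) : ATokens P K := s.inp + s.read + s.rest

/-- The tokens of `bᵢ` that are not consumed. -/
def Split.kept (s : Split P K) : ATokens P K := s.read + s.rest

/-- The effect of firing `t` on abstract markings. `H`, `z`, `L` decompose the multisets of `B` with
negative, zero and positive index, `Ohat` and `Ozero` are the new tokens with positive and with zero
fractional part. A strictly monotone injection `f` of the indices with `f 0 = 0` is a pair of
strictly monotone injections of the positions in `high` and in `low`; that there is one along which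
all multisets of kept tokens are contained in the new ones is the relation
`List.SublistForall₂ (· ≤ ·)` between the words. -/
def AFire {Q : Type*} (t : Transition Q P) (B B' : AMarking P K) : Prop :=
  ∃ (H L : List (Split P K)) (z : Split P K) (Ohat Ozero : ATokens P K)
    (cHigh cLow : List (ATokens P K)),
    B.high = H.map Split.total ∧ B.zero = z.total ∧ B.low = L.map Split.total ∧
    (∀ e : ℝ≥0, 0 < e → e < 1 →
      Match (shift e ((H.map Split.inp).sum + (L.map Split.inp).sum) + shift 0 z.inp) t.inputs ∧
      Match (shift e ((H.map Split.read).sum + (L.map Split.read).sum) + shift 0 z.read) t.reads ∧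
      Match (shift e Ohat + shift 0 Ozero) t.outputs) ∧
    List.SublistForall₂ (· ≤ ·) (H.map Split.kept) cHigh ∧
    List.SublistForall₂ (· ≤ ·) (L.map Split.kept) cLow ∧
    cHigh.sum + cLow.sum = (H.map Split.kept).sum + (L.map Split.kept).sum + Ohat ∧
    B' = ⟨reduce cHigh, z.kept + Ozero, reduce cLow⟩

end AMarking

/-! ## The abstract net -/

namespace PTPN

variable {Q P : Type*} (N : PTPN Q P)

/-- The configurations of the abstract net. -/
abbrev AConf := Q × AMarking P N.cmax

/-- The abstraction of a configuration. -/
def aptpn (c : Q × Marking P) : N.AConf := (c.1, absMarking N.cmax c.2)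

/-- The abstraction of a set of configurations, restricted to its members in `2/5`-form. -/
def aptpnSet (S : Set (Q × Marking P)) : Set N.AConf :=
  N.aptpn '' {c ∈ S | InDeltaForm (2 / 5) c.2}

/-- The transitions of the abstract net between its configurations, together with their costs.
The four types of abstract timed transitions start in markings `(h, b₀, l)` where the members of `h`
and `l` are nonempty; the multiset `b₀` may be empty, and it is then dropped where it would become a
member of a word. In the types 3 and 4 the word `l` is cut behind its `k`-th member. -/
inductive AStep : N.AConf → ℝ≥0 → N.AConf → Prop
  | disc (t : {t // t ∈ N.transitions}) (B B' : AMarking P N.cmax) (h : AFire t.1 B B') :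
      AStep (t.1.source, B) (N.transCost t : ℝ≥0) (t.1.target, B')
  | type1 (q : Q) (B : AMarking P N.cmax) (hB : B.Reduced) :
      AStep (q, B) 0 (q, ⟨B.high, 0, reduce [B.zero] ++ B.low⟩)
  | type2 (q : Q) (h l : List (ATokens P N.cmax)) (b : ATokens P N.cmax)
      (hB : (AMarking.mk (h ++ [b]) 0 l).Reduced) :
      AStep (q, ⟨h ++ [b], 0, l⟩) 0 (q, ⟨h, succAge b, l⟩)
  | type3 (q : Q) (h l₁ l₂ : List (ATokens P N.cmax)) (b₀ : ATokens P N.cmax)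
      (hB : (AMarking.mk h b₀ (l₁ ++ l₂)).Reduced) :
      AStep (q, ⟨h, b₀, l₁ ++ l₂⟩)
        (N.storageCost (AMarking.mk h b₀ (l₁ ++ l₂)).tokens : ℝ≥0)
        (q, ⟨h.map succAge ++ reduce [b₀] ++ l₁, 0, l₂.map succAge⟩)
  | type4 (q : Q) (h l₁ l₂ : List (ATokens P N.cmax)) (b₀ b : ATokens P N.cmax)
      (hB : (AMarking.mk h b₀ (l₁ ++ b :: l₂)).Reduced) :
      AStep (q, ⟨h, b₀, l₁ ++ b :: l₂⟩)
        (N.storageCost (AMarking.mk h b₀ (l₁ ++ b :: l₂)).tokens : ℝ≥0)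
        (q, ⟨h.map succAge ++ reduce [b₀] ++ l₁, succAge b, l₂.map succAge⟩)

end PTPN

end PTPNCost

end

noncomputable section

namespace PTPNCost

/-! ## Multisets: refinements of sums -/

section Refine

variable {A B : Type*}

/-! An interval with integer bounds up to `cmax` sees of an age only whether its fractional part
vanishes and its integral part, capped at `cmax + 1`. So a marking can be treated as a word of
layers, one for each fractional part; moving the layers inside `(0, 1)` changes nothing for firing,
and only their order matters for the passage of time. The relation `Rep K u v M B` ties a marking to
an abstract one in this way: low layers sit in `(0, u]`, high layers in `(v, 1)`. Each direction of
the theorem uses its own choice of `u` and `v`.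

An abstract computation is followed by the net with `u = δ` and `v = 1 - δ`, so that all ages stay
near integers. Types 1 and 2 become delays of at most `δ`, which are almost free; types 3 and 4
become delays slightly below one, which cost at most the abstract price. Each step at most triples
`δ` (`AStep.simulate`). Since a computation is finite, a sufficiently small initial `δ` makes the
total excess at most any given `ε` (`exists_comp_of_abstract`). The excess need not vanish, so only
the infima are compared.

Conversely, a computation of the net is followed by the abstract net with `u = v` equal to the phase
of a clock that advances with time. Layers beyond the phase are those that reach an integer before
the clock does. One unit of storage is paid at each tick of the clock (`exists_comp_of_delay`), so a
delay `x` started at phase `ψ` is charged `⌊ψ + x⌋ - ⌊ψ⌋` times. The mean of this number over `ψ ∈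
[0, 1]` is `x` (`integral_floor_sub_floor`). Hence the abstract cost, averaged over the initial
phase, equals the real cost (`exists_abstract_comp`), and some phase costs no more than the average.
The empty initial marking is compatible with every phase, and every reduced abstract marking is the
abstraction of a marking in `2/5`-form (`AMarking.Reduced.exists_absMarking_eq`), so the final set
imposes nothing beyond the control state. -/

lemma exists_refinement {X Y U V : Multiset A} (h : X + Y = U + V) :
    ∃ a b c d, X = a + b ∧ Y = c + d ∧ U = a + c ∧ V = b + d := by
  classical
  refine ⟨X ∩ U, X - U, U - X, Y - (U - X), ?_, ?_, ?_, ?_⟩ <;>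
  · ext x
    have := congrArg (Multiset.count x) h
    simp only [Multiset.count_add, Multiset.count_inter, Multiset.count_sub] at *
    omega

lemma exists_refinement₃ {X Y U V W : Multiset A} (h : X + Y = U + V + W) :
    ∃ a b c a' b' c', X = a + b + c ∧ Y = a' + b' + c' ∧ U = a + a' ∧ V = b + b' ∧ W = c + c' := by
  obtain ⟨a, b, c, d, rfl, rfl, hUV, rfl⟩ := exists_refinement h
  obtain ⟨a', b', c', d', rfl, rfl, rfl, rfl⟩ := exists_refinement hUV
  exact ⟨a', c', b, b', d', d, rfl, rfl, rfl, rfl, rfl⟩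

lemma exists_of_map_eq_add (g : A → B) {b : Multiset A} {U V : Multiset B}
    (h : b.map g = U + V) : ∃ u v, b = u + v ∧ u.map g = U ∧ v.map g = V := by
  classical
  induction b using Multiset.induction generalizing U V with
  | empty =>
    have h' : U + V = 0 := by simpa using h.symm
    obtain ⟨rfl, rfl⟩ := add_eq_zero.1 h'
    exact ⟨0, 0, by simp⟩
  | cons x b ih =>
    have hx : g x ∈ U + V := by rw [← h]; simp
    rcases Multiset.mem_add.1 hx with hx | hx <;> obtain ⟨W, rfl⟩ := Multiset.exists_cons_of_mem hx
    · obtain ⟨u, v, rfl, rfl, rfl⟩ := ih (U := W) (V := V) (by simpa using h)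
      exact ⟨x ::ₘ u, v, by simp⟩
    · obtain ⟨u, v, rfl, rfl, rfl⟩ := ih (U := U) (V := W) (by simpa using h)
      exact ⟨u, x ::ₘ v, by simp⟩

lemma exists_of_map_eq_add₃ (g : A → B) {b : Multiset A} {U V W : Multiset B}
    (h : b.map g = U + V + W) :
    ∃ u v w, b = u + v + w ∧ u.map g = U ∧ v.map g = V ∧ w.map g = W := by
  obtain ⟨x, w, rfl, hx, rfl⟩ := exists_of_map_eq_add g h
  obtain ⟨u, v, rfl, rfl, rfl⟩ := exists_of_map_eq_add g hx
  exact ⟨u, v, w, rfl, rfl, rfl, rfl⟩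

end Refine

/-! ## Markings as words of layers -/

section Layers

variable {P : Type*} {K : ℕ}

/-- A layer: a fractional part together with tokens that are given by the integral parts of their
ages. -/
abbrev Layer (P : Type*) := ℝ≥0 × Multiset (P × ℕ)

/-- The tokens of `b` with their ages increased by `f`. -/
def place (f : ℝ≥0) (b : Multiset (P × ℕ)) : Marking P :=
  b.map fun a => (a.1, (a.2 : ℝ≥0) + f)

/-- The marking that consists of the given layers. -/
def conc (w : List (Layer P)) : Marking P := (w.map fun l => place l.1 l.2).sum

/-- The abstract tokens with the given ages. -/
def cut (K : ℕ) (b : Multiset (P × ℕ)) : ATokens P K := b.map fun a => (a.1, cutAge K a.2)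

/-- The word of abstract tokens that belongs to a word of layers. -/
def word (K : ℕ) (w : List (Layer P)) : List (ATokens P K) := w.map fun l => cut K l.2

/-- All tokens become older by one. -/
def older (b : Multiset (P × ℕ)) : Multiset (P × ℕ) := b.map fun a => (a.1, a.2 + 1)

@[simp] lemma place_zero_tokens (f : ℝ≥0) : place f (0 : Multiset (P × ℕ)) = 0 := rfl
@[simp] lemma place_add (f : ℝ≥0) (b c : Multiset (P × ℕ)) :
    place f (b + c) = place f b + place f c := Multiset.map_add _ _ _
@[simp] lemma cut_zero : cut K (0 : Multiset (P × ℕ)) = 0 := rfl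
@[simp] lemma cut_add (b c : Multiset (P × ℕ)) : cut K (b + c) = cut K b + cut K c :=
  Multiset.map_add _ _ _
@[simp] lemma cut_eq_zero {b : Multiset (P × ℕ)} : cut K b = 0 ↔ b = 0 := Multiset.map_eq_zero
@[simp] lemma succAge_eq_zero {b : ATokens P K} : succAge b = 0 ↔ b = 0 := Multiset.map_eq_zero
@[simp] lemma conc_nil : conc ([] : List (Layer P)) = 0 := rfl
@[simp] lemma conc_cons (l : Layer P) (w : List (Layer P)) :
    conc (l :: w) = place l.1 l.2 + conc w := by simp [conc]
@[simp] lemma conc_append (w w' : List (Layer P)) : conc (w ++ w') = conc w + conc w' := by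
  simp [conc]
@[simp] lemma word_nil : word K ([] : List (Layer P)) = [] := rfl
@[simp] lemma word_cons (l : Layer P) (w : List (Layer P)) :
    word K (l :: w) = cut K l.2 :: word K w := rfl
@[simp] lemma word_append (w w' : List (Layer P)) : word K (w ++ w') = word K w ++ word K w' := by
  simp [word]
@[simp] lemma delay_add_marking (x : ℝ≥0) (M M' : Marking P) :
    delay x (M + M') = delay x M + delay x M' := Multiset.map_add _ _ _

lemma delay_delay (x y : ℝ≥0) (M : Marking P) : delay y (delay x M) = delay (x + y) M := by
  simp [delay, Multiset.map_map, add_assoc]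

lemma delay_place (x f : ℝ≥0) (b : Multiset (P × ℕ)) : delay x (place f b) = place (f + x) b := by
  simp [delay, place, Multiset.map_map, add_assoc]

lemma place_add_one (f : ℝ≥0) (b : Multiset (P × ℕ)) : place (f + 1) b = place f (older b) := by
  simp only [place, older, Multiset.map_map, Function.comp_def]
  congr 1; ext a <;> simp; ring

lemma cut_older (b : Multiset (P × ℕ)) : cut K (older b) = succAge (cut K b) := by
  simp only [cut, older, succAge, Multiset.map_map, Function.comp_def]
  congr 1; ext a
  · rfl
  · simp only [cutAge]; omega

/-- The layers of `w`, with the fractional parts increased by `x`. -/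
def shiftLayers (x : ℝ≥0) (w : List (Layer P)) : List (Layer P) := w.map fun l => (l.1 + x, l.2)

/-- The layers of `w`, with the fractional parts increased by `x` and decreased by `1`. -/
def wrapLayers (x : ℝ≥0) (w : List (Layer P)) : List (Layer P) :=
  w.map fun l => (l.1 + x - 1, older l.2)

lemma conc_shiftLayers (x : ℝ≥0) (w : List (Layer P)) :
    conc (shiftLayers x w) = delay x (conc w) := by
  induction w with
  | nil => rfl
  | cons l w ih =>
    simp only [shiftLayers, List.map_cons, conc_cons, delay_add_marking, delay_place] at ih ⊢
    rw [ih]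

/-- The hypothesis keeps the truncated subtraction of `1` exact; the lost unit is returned by
`older`. -/
lemma conc_wrapLayers {x : ℝ≥0} {w : List (Layer P)} (h : ∀ l ∈ w, 1 ≤ l.1 + x) :
    conc (wrapLayers x w) = delay x (conc w) := by
  induction w with
  | nil => rfl
  | cons l w ih =>
    simp only [List.mem_cons, forall_eq_or_imp] at h
    simp only [wrapLayers, List.map_cons, conc_cons, delay_add_marking, delay_place] at ih ⊢
    rw [ih h.2, ← place_add_one, tsub_add_cancel_of_le h.1]

@[simp] lemma word_shiftLayers (x : ℝ≥0) (w : List (Layer P)) :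
    word K (shiftLayers x w) = word K w := by
  simp [word, shiftLayers]

@[simp] lemma word_wrapLayers (x : ℝ≥0) (w : List (Layer P)) :
    word K (wrapLayers x w) = (word K w).map succAge := by
  simp [word, wrapLayers, cut_older]

/-- The fractional parts of the layers increase. -/
def Increasing (w : List (Layer P)) : Prop := w.Pairwise fun l l' => l.1 < l'.1

lemma Increasing.shiftLayers {w : List (Layer P)} (h : Increasing w) (x : ℝ≥0) :
    Increasing (shiftLayers x w) := by
  refine List.pairwise_map.2 (List.Pairwise.imp ?_ h)
  intro a b hab
  simpa using hab

lemma Increasing.wrapLayers {w : List (Layer P)} (h : Increasing w) {x : ℝ≥0}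
    (h1 : ∀ l ∈ w, 1 ≤ l.1 + x) : Increasing (wrapLayers x w) := by
  refine List.pairwise_map.2 (List.Pairwise.imp_of_mem ?_ h)
  intro a b ha hb hab
  exact (tsub_lt_tsub_iff_right (h1 a ha)).2 (by simpa using hab)

/-- The layers without tokens are deleted. -/
def dropEmpty (w : List (Layer P)) : List (Layer P) := by
  classical exact w.filter fun l => l.2 ≠ 0

@[simp] lemma conc_dropEmpty (w : List (Layer P)) : conc (dropEmpty w) = conc w := by
  classical
  induction w with
  | nil => rfl
  | cons l w ih =>
    by_cases h : l.2 = 0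
    · simp_all [dropEmpty]
    · simp_all [dropEmpty]

@[simp] lemma word_dropEmpty (w : List (Layer P)) : word K (dropEmpty w) = reduce (word K w) := by
  classical
  induction w with
  | nil => rfl
  | cons l w ih =>
    by_cases h : l.2 = 0
    · simp_all [dropEmpty, reduce]
    · simp_all [dropEmpty, reduce]

lemma Increasing.dropEmpty {w : List (Layer P)} (h : Increasing w) : Increasing (dropEmpty w) :=
  List.Pairwise.filter _ h

lemma mem_of_mem_dropEmpty {w : List (Layer P)} {l : Layer P} (h : l ∈ dropEmpty w) : l ∈ w :=
  List.mem_of_mem_filter h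

lemma mem_reduce {w : List (ATokens P K)} {b : ATokens P K} : b ∈ reduce w ↔ b ∈ w ∧ b ≠ 0 := by
  classical
  simp [reduce]

/-- `M` consists of layers with increasing fractional parts, those in `(v, 1)` and in `(0, u]` being
described by the words of the abstract marking `B`. -/
def Rep (K : ℕ) (u v : ℝ≥0) (M : Marking P) (B : AMarking P K) : Prop :=
  ∃ (hs : List (Layer P)) (z : Multiset (P × ℕ)) (ls : List (Layer P)),
    M = conc hs + place 0 z + conc ls ∧ B = ⟨word K hs, cut K z, word K ls⟩ ∧
    Increasing hs ∧ Increasing ls ∧ (∀ l ∈ hs, v < l.1 ∧ l.1 < 1) ∧ ∀ l ∈ ls, 0 < l.1 ∧ l.1 ≤ u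

end Layers

/-! ## Storage costs -/

namespace PTPN

variable {Q P : Type*} (N : PTPN Q P) {A : Type*}

@[simp] lemma storageCost_zero : N.storageCost (0 : Multiset (P × A)) = 0 := rfl

@[simp] lemma storageCost_add (M M' : Multiset (P × A)) :
    N.storageCost (M + M') = N.storageCost M + N.storageCost M' := by
  simp [storageCost]

@[simp] lemma storageCost_delay (x : ℝ≥0) (M : Marking P) :
    N.storageCost (delay x M) = N.storageCost M := by
  simp [storageCost, delay, Multiset.map_map]

lemma storageCost_place (K : ℕ) (f : ℝ≥0) (b : Multiset (P × ℕ)) :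
    N.storageCost (place f b) = N.storageCost (cut K b) := by
  simp [storageCost, place, cut, Multiset.map_map]

lemma storageCost_conc (K : ℕ) (w : List (Layer P)) :
    N.storageCost (conc w) = N.storageCost (word K w).sum := by
  induction w with
  | nil => rfl
  | cons l w ih => simp [ih, N.storageCost_place K]

end PTPN

lemma Rep.storageCost_eq {Q P : Type*} (N : PTPN Q P) {K : ℕ} {u v : ℝ≥0} {M : Marking P}
    {B : AMarking P K} (h : Rep K u v M B) : N.storageCost B.tokens = N.storageCost M := by
  obtain ⟨hs, z, ls, rfl, rfl, -⟩ := h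
  simp [AMarking.tokens, N.storageCost_conc K, N.storageCost_place K]

/-! ## Computations -/

lemma Comp.single {C : Type*} {step : C → ℝ≥0 → C → Prop} {c d : C} {r : ℝ≥0} (h : step c r d) :
    Comp step c r d := by
  simpa using Comp.cons h (Comp.refl d)

lemma Comp.trans {C : Type*} {step : C → ℝ≥0 → C → Prop} {c d e : C} {r s : ℝ≥0}
    (h : Comp step c r d) (h' : Comp step d s e) : Comp step c (r + s) e := by
  induction h with
  | refl => simpa
  | cons h _ ih => rw [add_assoc]; exact Comp.cons h (ih h')

/-! ## Regions -/

section Regions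

variable {P : Type*} {K : ℕ}

/-- No integer lies strictly between `n` and `n + 1`, so neither `f` nor the openness of the
interval plays a role. -/
lemma Intrv.contains_add_iff (J : Intrv) {n : ℕ} {f : ℝ≥0} (h0 : 0 < f) (h1 : f < 1) :
    J.Contains (n + f) ↔ J.lower ≤ n ∧ ∀ z : ℕ, J.upper = z → n < z := by
  have key : ∀ z : ℕ, ((z : ℝ≥0) ≤ n + f ↔ z ≤ n) ∧ ((z : ℝ≥0) < n + f ↔ z ≤ n) ∧
      ((n : ℝ≥0) + f ≤ z ↔ n < z) ∧ ((n : ℝ≥0) + f < z ↔ n < z) := by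
    intro z
    rcases Nat.lt_or_ge n z with h | h
    · have h' : (n : ℝ≥0) + 1 ≤ z := by exact_mod_cast h
      have h2 : (n : ℝ≥0) + f < z := lt_of_lt_of_le (by gcongr) h'
      simp [h, h2, h2.le, h.not_ge, h2.not_ge, h2.not_gt]
    · have h' : (z : ℝ≥0) ≤ n := by exact_mod_cast h
      have h2 : (z : ℝ≥0) < n + f := lt_of_le_of_lt h' (by simpa using h0)
      simp [h, h2, h2.le, h.not_gt, h2.not_ge, h2.not_gt]
  unfold Intrv.Contains
  simp only [key]
  simp

lemma Intrv.contains_nat_iff (J : Intrv) (n : ℕ) :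
    J.Contains n ↔ (if J.lowerClosed then J.lower ≤ n else J.lower < n) ∧
      ∀ z : ℕ, J.upper = z → if J.upperClosed then n ≤ z else n < z := by
  unfold Intrv.Contains
  simp

lemma Intrv.upper_le {J : Intrv} {z : ℕ} (hJ : J.maxBound ≤ K) (h : J.upper = z) : z ≤ K := by
  have : J.upper.toNat ≤ K := (le_max_right _ _).trans hJ
  simpa [h] using this

lemma Intrv.lower_le {J : Intrv} (hJ : J.maxBound ≤ K) : J.lower ≤ K := (le_max_left _ _).trans hJ

/-- The ages `x` and `y` lie in the same intervals with bounds up to `K`. -/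
def SameAge (K : ℕ) (x y : ℝ≥0) : Prop :=
  ∀ J : Intrv, J.maxBound ≤ K → (J.Contains x ↔ J.Contains y)

lemma sameAge_add (n : ℕ) {f e : ℝ≥0} (hf : 0 < f) (hf1 : f < 1) (he : 0 < e) (he1 : e < 1) :
    SameAge K (n + f) (((cutAge K n : Fin (K + 2)) : ℕ) + e) := by
  intro J hJ
  rw [J.contains_add_iff hf hf1, J.contains_add_iff he he1]
  have h1 := J.lower_le hJ
  have h2 : J.lower ≤ n ↔ J.lower ≤ (cutAge K n : ℕ) := by simp only [cutAge]; omega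
  refine and_congr h2 (forall_congr' fun z => forall_congr' fun hz => ?_)
  have h3 := J.upper_le hJ hz
  simp only [cutAge]; omega

/-- Openness now matters, and a closed interval may end at `K` itself; this is why ages are capped
at `K + 1` and not at `K`. -/
lemma sameAge_nat (n : ℕ) : SameAge K n ((cutAge K n : Fin (K + 2)) : ℕ) := by
  intro J hJ
  rw [J.contains_nat_iff, J.contains_nat_iff]
  have h1 := J.lower_le hJ
  refine and_congr ?_ (forall_congr' fun z => forall_congr' fun hz => ?_)
  · simp only [cutAge]; split_ifs <;> omega
  · have h3 := J.upper_le hJ hz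
    simp only [cutAge]; split_ifs <;> omega

/-- The markings agree up to the replacement of ages by ages in the same intervals. -/
def SameRegions (K : ℕ) (M M' : Marking P) : Prop :=
  Multiset.Rel (fun a b => a.1 = b.1 ∧ SameAge K a.2 b.2) M M'

lemma SameRegions.symm {M M' : Marking P} (h : SameRegions K M M') : SameRegions K M' M :=
  Multiset.rel_flip.1 <| Multiset.Rel.mono h fun _ _ _ _ hab =>
    ⟨hab.1.symm, fun J hJ => (hab.2 J hJ).symm⟩

lemma SameRegions.add {M M' L L' : Marking P} (h : SameRegions K M M') (h' : SameRegions K L L') :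
    SameRegions K (M + L) (M' + L') := Multiset.Rel.add h h'

lemma SameRegions.match {M M' : Marking P} (h : SameRegions K M M')
    {arcs : Multiset (P × Intrv)} (harcs : ∀ a ∈ arcs, a.2.maxBound ≤ K) (hM : Match M arcs) :
    Match M' arcs := by
  induction M using Multiset.induction generalizing M' arcs with
  | empty =>
    rw [Multiset.rel_zero_left.1 h]; exact hM
  | cons a M ih =>
    obtain ⟨b, M₁, hab, h₁, rfl⟩ := Multiset.rel_cons_left.1 h
    obtain ⟨c, arcs, hac, h₂, rfl⟩ := Multiset.rel_cons_left.1 hM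
    exact Multiset.rel_cons_left.2 ⟨c, arcs, ⟨hab.1 ▸ hac.1,
      (hab.2 c.2 (harcs c (by simp))).1 hac.2⟩, ih h₁ (fun a ha => harcs a (by simp [ha])) h₂, rfl⟩

@[simp] lemma shift_add (e : ℝ≥0) (b c : ATokens P K) :
    shift e (b + c) = shift e b + shift e c := Multiset.map_add _ _ _

lemma sameRegions_place {f e : ℝ≥0} (hf : 0 < f) (hf1 : f < 1) (he : 0 < e) (he1 : e < 1)
    (b : Multiset (P × ℕ)) : SameRegions K (place f b) (shift e (cut K b)) := by
  simp only [SameRegions, place, shift, cut, Multiset.map_map, Multiset.rel_map]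
  exact Multiset.rel_refl_of_refl_on fun a _ => ⟨rfl, sameAge_add a.2 hf hf1 he he1⟩

lemma sameRegions_place_zero (b : Multiset (P × ℕ)) :
    SameRegions K (place 0 b) (shift 0 (cut K b)) := by
  simp only [SameRegions, place, shift, cut, Multiset.map_map, Multiset.rel_map]
  exact Multiset.rel_refl_of_refl_on fun a _ => ⟨rfl, by simpa using sameAge_nat a.2⟩

lemma sameRegions_conc {e : ℝ≥0} (he : 0 < e) (he1 : e < 1) {w : List (Layer P)}
    (hw : ∀ l ∈ w, 0 < l.1 ∧ l.1 < 1) : SameRegions K (conc w) (shift e (word K w).sum) := by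
  induction w with
  | nil => exact Multiset.Rel.zero
  | cons l w ih =>
    simp only [List.mem_cons, forall_eq_or_imp] at hw
    simp only [conc_cons, word_cons, List.sum_cons, shift_add]
    exact (sameRegions_place hw.1.1 hw.1.2 he he1 _).add (ih hw.2)

lemma sameRegions_layers {e : ℝ≥0} (he : 0 < e) (he1 : e < 1) {hs ls : List (Layer P)}
    (z : Multiset (P × ℕ)) (hhs : ∀ l ∈ hs, 0 < l.1 ∧ l.1 < 1) (hls : ∀ l ∈ ls, 0 < l.1 ∧ l.1 < 1) :
    SameRegions K (conc hs + place 0 z + conc ls)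
      (shift e ((word K hs).sum + (word K ls).sum) + shift 0 (cut K z)) := by
  rw [shift_add, add_right_comm]
  exact ((sameRegions_conc he he1 hhs).add (sameRegions_conc he he1 hls)).add
    (sameRegions_place_zero z)

end Regions

lemma PTPN.maxBound_le_cmax {Q P : Type*} (N : PTPN Q P) {t : Transition Q P}
    (ht : t ∈ N.transitions) {a : P × Intrv} (ha : a ∈ t.inputs + t.reads + t.outputs) :
    a.2.maxBound ≤ N.cmax := by
  refine le_trans ?_ (Finset.le_sup (f := fun t : Transition Q P =>
    ((t.inputs + t.reads + t.outputs).map fun a => a.2.maxBound).sup) ht)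
  exact Multiset.le_sup (Multiset.mem_map_of_mem _ ha)

/-! ## Decompositions of layers -/

section Splits

variable {P : Type*} {K : ℕ}

/-- A decomposition of the tokens of a layer into consumed tokens, read tokens and other tokens. -/
structure LayerSplit (P : Type*) where
  inp : Multiset (P × ℕ)
  read : Multiset (P × ℕ)
  rest : Multiset (P × ℕ)

namespace LayerSplit

/-- The decomposed tokens. -/
def total (s : LayerSplit P) : Multiset (P × ℕ) := s.inp + s.read + s.rest

/-- The tokens that are not consumed. -/
def kept (s : LayerSplit P) : Multiset (P × ℕ) := s.read + s.rest

/-- The corresponding decomposition of abstract tokens. -/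
def toSplit (K : ℕ) (s : LayerSplit P) : Split P K := ⟨cut K s.inp, cut K s.read, cut K s.rest⟩

@[simp] lemma toSplit_total (s : LayerSplit P) : (s.toSplit K).total = cut K s.total := by
  simp [toSplit, total, Split.total]

@[simp] lemma toSplit_kept (s : LayerSplit P) : (s.toSplit K).kept = cut K s.kept := by
  simp [toSplit, kept, Split.kept]

end LayerSplit

/-- The layers that consist of a part of each decomposed layer. -/
def part (g : LayerSplit P → Multiset (P × ℕ)) (S : List (ℝ≥0 × LayerSplit P)) : List (Layer P) :=
  S.map (Prod.map id g)

/-- The word of abstract decompositions. -/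
def splits (K : ℕ) (S : List (ℝ≥0 × LayerSplit P)) : List (Split P K) :=
  S.map fun s => s.2.toSplit K

lemma conc_part_total (S : List (ℝ≥0 × LayerSplit P)) :
    conc (part LayerSplit.total S) = conc (part LayerSplit.inp S) + conc (part LayerSplit.read S) +
      conc (part LayerSplit.rest S) := by
  induction S with
  | nil => rfl
  | cons s S ih =>
    simp only [part, List.map_cons, conc_cons, Prod.map_fst, Prod.map_snd, LayerSplit.total,
      place_add] at ih ⊢
    rw [ih]; abel

lemma conc_part_kept (S : List (ℝ≥0 × LayerSplit P)) :
    conc (part LayerSplit.kept S) =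
      conc (part LayerSplit.read S) + conc (part LayerSplit.rest S) := by
  induction S with
  | nil => rfl
  | cons s S ih =>
    simp only [part, List.map_cons, conc_cons, Prod.map_fst, Prod.map_snd, LayerSplit.kept,
      place_add] at ih ⊢
    rw [ih]; abel

lemma map_total_splits (S : List (ℝ≥0 × LayerSplit P)) :
    (splits K S).map Split.total = word K (part LayerSplit.total S) := by simp [splits, word, part]
lemma map_kept_splits (S : List (ℝ≥0 × LayerSplit P)) :
    (splits K S).map Split.kept = word K (part LayerSplit.kept S) := by simp [splits, word, part]
lemma map_inp_splits (S : List (ℝ≥0 × LayerSplit P)) :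
    (splits K S).map Split.inp = word K (part LayerSplit.inp S) := by
  simp [splits, word, part, LayerSplit.toSplit]
lemma map_read_splits (S : List (ℝ≥0 × LayerSplit P)) :
    (splits K S).map Split.read = word K (part LayerSplit.read S) := by
  simp [splits, word, part, LayerSplit.toSplit]

lemma increasing_part {g : LayerSplit P → Multiset (P × ℕ)} {S : List (ℝ≥0 × LayerSplit P)} :
    Increasing (part g S) ↔ S.Pairwise fun s s' => s.1 < s'.1 := by
  simp [Increasing, part, List.pairwise_map]

lemma forall_mem_part {g : LayerSplit P → Multiset (P × ℕ)} {S : List (ℝ≥0 × LayerSplit P)}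
    {p : ℝ≥0 → Prop} : (∀ l ∈ part g S, p l.1) ↔ ∀ s ∈ S, p s.1 := by
  unfold part
  rw [List.forall_mem_map]
  rfl

lemma exists_place_eq_add {f : ℝ≥0} {b : Multiset (P × ℕ)} {I R M : Marking P}
    (h : place f b = I + R + M) : ∃ s : LayerSplit P,
      b = s.total ∧ place f s.inp = I ∧ place f s.read = R ∧ place f s.rest = M := by
  obtain ⟨u, v, w, h, h1, h2, h3⟩ := exists_of_map_eq_add₃ _ h
  exact ⟨⟨u, v, w⟩, h, h1, h2, h3⟩

lemma exists_conc_eq_add {w : List (Layer P)} {I R M : Marking P} (h : conc w = I + R + M) :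
    ∃ S : List (ℝ≥0 × LayerSplit P), w = part LayerSplit.total S ∧
      conc (part LayerSplit.inp S) = I ∧ conc (part LayerSplit.read S) = R ∧
      conc (part LayerSplit.rest S) = M := by
  induction w generalizing I R M with
  | nil =>
    have h' : I + R + M = 0 := by simpa using h.symm
    simp only [add_eq_zero] at h'
    obtain ⟨⟨rfl, rfl⟩, rfl⟩ := h'
    exact ⟨[], rfl, rfl, rfl, rfl⟩
  | cons l w ih =>
    rw [conc_cons] at h
    obtain ⟨a, b, c, a', b', c', h1, h2, rfl, rfl, rfl⟩ := exists_refinement₃ h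
    obtain ⟨s, hs, rfl, rfl, rfl⟩ := exists_place_eq_add h1
    obtain ⟨S, rfl, rfl, rfl, rfl⟩ := ih h2
    refine ⟨(l.1, s) :: S, ?_, rfl, rfl, rfl⟩
    simp [part, ← hs]

lemma exists_cut_eq_total {b : Multiset (P × ℕ)} {s : Split P K} (h : cut K b = s.total) :
    ∃ s' : LayerSplit P, b = s'.total ∧ s'.toSplit K = s := by
  obtain ⟨u, v, w, h, h1, h2, h3⟩ := exists_of_map_eq_add₃ _ h
  refine ⟨⟨u, v, w⟩, h, ?_⟩
  simp only [LayerSplit.toSplit, cut, h1, h2, h3]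

lemma exists_word_eq_map_total {w : List (Layer P)} {H : List (Split P K)}
    (h : word K w = H.map Split.total) :
    ∃ S : List (ℝ≥0 × LayerSplit P), w = part LayerSplit.total S ∧ splits K S = H := by
  induction w generalizing H with
  | nil =>
    exact ⟨[], rfl, (List.map_eq_nil_iff.1 h.symm).symm⟩
  | cons l w ih =>
    cases H with
    | nil => simp at h
    | cons s H =>
      simp only [word_cons, List.map_cons, List.cons.injEq] at h
      obtain ⟨s', hs, rfl⟩ := exists_cut_eq_total h.1
      obtain ⟨S, rfl, rfl⟩ := ih h.2
      refine ⟨(l.1, s') :: S, ?_, rfl⟩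
      simp [part, ← hs]

end Splits

/-! ## Discrete steps -/

section Fire

variable {Q P : Type*} {K : ℕ}

lemma exists_below {lo hi : ℝ≥0} (h : lo < hi) {w : List (Layer P)} (hw : ∀ l ∈ w, lo < l.1) :
    ∃ f, lo < f ∧ f < hi ∧ ∀ l ∈ w, f < l.1 := by
  induction w with
  | nil =>
    obtain ⟨f, h1, h2⟩ := exists_between h
    exact ⟨f, h1, h2, by simp⟩
  | cons l w ih =>
    simp only [List.mem_cons, forall_eq_or_imp] at hw
    obtain ⟨g, h1, h2, h3⟩ := ih hw.2
    obtain ⟨f, h4, h5⟩ := exists_between (lt_min h1 hw.1)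
    rw [lt_min_iff] at h5
    refine ⟨f, h4, h5.1.trans h2, ?_⟩
    simp only [List.mem_cons, forall_eq_or_imp]
    exact ⟨h5.2, fun l hl => h5.1.trans (h3 l hl)⟩

/-- Tokens whose ages have the given abstractions. -/
def lift (b : ATokens P K) : Multiset (P × ℕ) := b.map fun a => (a.1, (a.2 : ℕ))

@[simp] lemma cut_lift (b : ATokens P K) : cut K (lift b) = b := by
  have : ∀ a : Fin (K + 2), cutAge K (a : ℕ) = a := fun a => by
    ext; simp only [cutAge]; omega
  simp [cut, lift, Multiset.map_map, this]

/-- Turns an order-preserving embedding of words into actual fractional parts. Since `(lo, hi)` is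
open and dense, there is always room for another layer before, between or behind the given ones. The
layers `wE` collect what has been added, that is, the produced tokens. -/
lemma exists_extension {lo hi : ℝ≥0} (h : lo < hi) {w : List (Layer P)} {c : List (ATokens P K)}
    (hw : Increasing w) (hmem : ∀ l ∈ w, lo < l.1 ∧ l.1 < hi)
    (hc : List.SublistForall₂ (· ≤ ·) (word K w) c) :
    ∃ w' wE : List (Layer P), Increasing w' ∧ (∀ l ∈ w', lo < l.1 ∧ l.1 < hi) ∧
      (∀ l ∈ wE, lo < l.1 ∧ l.1 < hi) ∧ word K w' = c ∧ conc w' = conc w + conc wE ∧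
      c.sum = (word K w).sum + (word K wE).sum := by
  -- A letter of `c` with no counterpart in `w` is placed at some `f` below all of `w`; the
  -- remaining letters are then handled above `f`, which keeps the word increasing.
  have insertion : ∀ {lo : ℝ≥0} {w : List (Layer P)} {x : ATokens P K} {c : List (ATokens P K)},
      lo < hi → (∀ l ∈ w, lo < l.1 ∧ l.1 < hi) →
      (∀ f, lo < f → f < hi → (∀ l ∈ w, f < l.1) →
        ∃ w' wE : List (Layer P), Increasing w' ∧ (∀ l ∈ w', f < l.1 ∧ l.1 < hi) ∧
        (∀ l ∈ wE, f < l.1 ∧ l.1 < hi) ∧ word K w' = c ∧ conc w' = conc w + conc wE ∧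
        c.sum = (word K w).sum + (word K wE).sum) →
      ∃ w' wE : List (Layer P), Increasing w' ∧ (∀ l ∈ w', lo < l.1 ∧ l.1 < hi) ∧
        (∀ l ∈ wE, lo < l.1 ∧ l.1 < hi) ∧ word K w' = x :: c ∧ conc w' = conc w + conc wE ∧
        (x :: c).sum = (word K w).sum + (word K wE).sum := by
    intro lo w x c h hmem ih
    obtain ⟨f, h1, h2, h3⟩ := exists_below h fun l hl => (hmem l hl).1
    obtain ⟨w', wE, i1, i2, i3, i4, i5, i6⟩ := ih f h1 h2 h3
    refine ⟨(f, lift x) :: w', (f, lift x) :: wE, List.pairwise_cons.2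
      ⟨fun l hl => (i2 l hl).1, i1⟩, ?_, ?_, by simp [i4], ?_, ?_⟩
    · simp only [List.mem_cons, forall_eq_or_imp]
      exact ⟨⟨h1, h2⟩, fun l hl => ⟨h1.trans (i2 l hl).1, (i2 l hl).2⟩⟩
    · simp only [List.mem_cons, forall_eq_or_imp]
      exact ⟨⟨h1, h2⟩, fun l hl => ⟨h1.trans (i3 l hl).1, (i3 l hl).2⟩⟩
    · simp only [conc_cons, i5]; abel
    · simp only [word_cons, List.sum_cons, i6, cut_lift]; abel
  induction c generalizing lo w with
  | nil =>
    have : w = [] := by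
      generalize hx : word K w = x at hc
      cases hc
      simpa [word] using hx
    subst this
    exact ⟨[], [], hw, by simp, by simp, rfl, by simp, by simp⟩
  | cons x c ih =>
    generalize hx : word K w = y at hc
    cases hc with
    | nil =>
      have : w = [] := by simpa [word] using hx
      subst this
      rw [← hx]
      exact insertion h (by simp) fun f _ hf _ => ih hf hw (by simp) .nil
    | cons_right hc =>
      subst hx
      exact insertion h hmem fun f _ hf hf' =>
        ih hf hw (fun l hl => ⟨hf' l hl, (hmem l hl).2⟩) hc
    | cons hab hc =>
      cases w with
      | nil => simp at hx
      | cons l w =>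
        simp only [word_cons, List.cons.injEq] at hx
        obtain ⟨rfl, rfl⟩ := hx
        simp only [List.mem_cons, forall_eq_or_imp] at hmem
        obtain ⟨hl, hw⟩ := List.pairwise_cons.1 hw
        obtain ⟨w', wE, i1, i2, i3, i4, i5, i6⟩ :=
          ih hmem.1.2 hw (fun l' hl' => ⟨hl l' hl', (hmem.2 l' hl').2⟩) hc
        -- A matched letter keeps the position of its layer, and the surplus `d` is put there as
        -- well.
        obtain ⟨d, rfl⟩ := Multiset.le_iff_exists_add.1 hab
        refine ⟨(l.1, l.2 + lift d) :: w', (l.1, lift d) :: wE, List.pairwise_cons.2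
          ⟨fun l hl => (i2 l hl).1, i1⟩, ?_, ?_, by simp [i4], ?_, ?_⟩
        · simp only [List.mem_cons, forall_eq_or_imp]
          exact ⟨hmem.1, fun l hl => ⟨hmem.1.1.trans (i2 l hl).1, (i2 l hl).2⟩⟩
        · simp only [List.mem_cons, forall_eq_or_imp]
          exact ⟨hmem.1, fun l hl => ⟨hmem.1.1.trans (i3 l hl).1, (i3 l hl).2⟩⟩
        · simp only [conc_cons, place_add, i5]; abel
        · simp only [word_cons, List.sum_cons, i6, cut_lift]; abel

lemma exists_insert_token {w : List (Layer P)} (hw : Increasing w) (p : P) (n : ℕ) (f : ℝ≥0) :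
    ∃ w' : List (Layer P), Increasing w' ∧
      (∀ q : ℝ≥0 → Prop, q f → (∀ l ∈ w, q l.1) → ∀ l ∈ w', q l.1) ∧
      conc w' = (p, (n : ℝ≥0) + f) ::ₘ conc w ∧
      List.SublistForall₂ (· ≤ ·) (word K w) (word K w') ∧
      (word K w').sum = (p, cutAge K n) ::ₘ (word K w).sum := by
  have place_single : place f {(p, n)} = {(p, (n : ℝ≥0) + f)} := rfl
  have cut_single : cut K {(p, n)} = {(p, cutAge K n)} := rfl
  induction w with
  | nil =>
    refine ⟨[(f, {(p, n)})], List.pairwise_singleton _ _, by simp, ?_, .nil, ?_⟩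
    · simp [place_single]
    · simp [cut_single]
  | cons l w ih =>
    obtain ⟨hl, hw'⟩ := List.pairwise_cons.1 hw
    rcases lt_trichotomy f l.1 with h | h | h
    · refine ⟨(f, {(p, n)}) :: l :: w, List.pairwise_cons.2 ⟨?_, hw⟩, ?_, ?_, ?_, ?_⟩
      · simp only [List.mem_cons, forall_eq_or_imp]
        exact ⟨h, fun l' hl' => h.trans (hl l' hl')⟩
      · intro q hq hqw
        simpa [hq] using hqw
      · simp [place_single]
      · exact .cons_right (refl_of _ _)
      · simp [cut_single]
    · refine ⟨(l.1, {(p, n)} + l.2) :: w, List.pairwise_cons.2 ⟨hl, hw'⟩, ?_, ?_, ?_, ?_⟩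
      · intro q hq hqw
        simpa using hqw
      · rw [conc_cons, place_add, ← h, place_single]
        simp [h]
      · exact .cons (by simp only [cut_add]; exact le_add_self) (refl_of _ _)
      · rw [word_cons, cut_add, cut_single]
        simp
    · obtain ⟨w', i1, i2, i3, i4, i5⟩ := ih hw'
      refine ⟨l :: w', List.pairwise_cons.2 ⟨i2 (l.1 < ·) h hl, i1⟩, ?_, ?_, ?_, ?_⟩
      · intro q hq hqw
        simp only [List.mem_cons, forall_eq_or_imp] at hqw ⊢
        exact ⟨hqw.1, i2 q hq hqw.2⟩
      · simp [i3]
      · exact .cons le_rfl i4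
      · simp [i5]

/-- The concrete counterpart of the embedding in `AFire`: output tokens are inserted one at a time,
each at the position dictated by its own fractional part, and the single cut at `u` decides between
the two words. -/
lemma exists_add_marking {u : ℝ≥0} {hs ls : List (Layer P)} (hhs : Increasing hs)
    (hls : Increasing ls) (hhs' : ∀ l ∈ hs, u < l.1 ∧ l.1 < 1) (hls' : ∀ l ∈ ls, 0 < l.1 ∧ l.1 ≤ u)
    (O : Marking P) :
    ∃ (hs' : List (Layer P)) (z : Multiset (P × ℕ)) (ls' wO : List (Layer P)),
      Increasing hs' ∧ Increasing ls' ∧ (∀ l ∈ hs', u < l.1 ∧ l.1 < 1) ∧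
      (∀ l ∈ ls', 0 < l.1 ∧ l.1 ≤ u) ∧ (∀ l ∈ wO, 0 < l.1 ∧ l.1 < 1) ∧
      O = conc wO + place 0 z ∧ conc hs' + place 0 z + conc ls' = O + (conc hs + conc ls) ∧
      List.SublistForall₂ (· ≤ ·) (word K hs) (word K hs') ∧
      List.SublistForall₂ (· ≤ ·) (word K ls) (word K ls') ∧
      (word K hs').sum + (word K ls').sum =
        (word K hs).sum + (word K ls).sum + (word K wO).sum := by
  induction O using Multiset.induction with
  | empty =>
    exact ⟨hs, 0, ls, [], hhs, hls, hhs', hls', by simp, by simp, by simp, refl_of _ _, refl_of _ _,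
      by simp⟩
  | cons a O ih =>
    obtain ⟨hs', z, ls', wO, h1, h2, h3, h4, h5, h6, h7, h8, h9, h10⟩ := ih
    obtain ⟨p, x⟩ := a
    obtain ⟨n, f, rfl, hf⟩ : ∃ (n : ℕ) (f : ℝ≥0), x = n + f ∧ f < 1 := by
      refine ⟨⌊x⌋₊, x - ⌊x⌋₊, (add_tsub_cancel_of_le (Nat.floor_le zero_le)).symm, ?_⟩
      rw [tsub_lt_iff_left (Nat.floor_le zero_le)]
      exact Nat.lt_floor_add_one x
    have place_single : ∀ f : ℝ≥0, place f {(p, n)} = {(p, (n : ℝ≥0) + f)} := fun _ => rfl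
    have cut_single : cut K {(p, n)} = {(p, cutAge K n)} := rfl
    rcases (zero_le (a := f)).eq_or_lt with rfl | h0
    · refine ⟨hs', {(p, n)} + z, ls', wO, h1, h2, h3, h4, h5, ?_, ?_, h8, h9, h10⟩
      · rw [h6, place_add, place_single, ← Multiset.singleton_add]; abel
      · rw [place_add, place_single, ← Multiset.singleton_add, add_assoc _ O, ← h7]; abel
    · have hwO : ∀ l ∈ (f, {(p, n)}) :: wO, 0 < l.1 ∧ l.1 < 1 := by
        simp only [List.mem_cons, forall_eq_or_imp]
        exact ⟨⟨h0, hf⟩, h5⟩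
      have hO : (p, (n : ℝ≥0) + f) ::ₘ O = conc ((f, {(p, n)}) :: wO) + place 0 z := by
        rw [h6, conc_cons, place_single, ← Multiset.singleton_add]; abel
      rcases le_or_gt f u with h | h
      · obtain ⟨w', i1, i2, i3, i4, i5⟩ := exists_insert_token (K := K) h2 p n f
        refine ⟨hs', z, w', _, h1, i1, h3, i2 (fun f => 0 < f ∧ f ≤ u) ⟨h0, h⟩ h4, hwO, hO, ?_,
          h8, _root_.trans h9 i4, ?_⟩
        · rw [i3, Multiset.cons_add, ← h7, Multiset.add_cons]
        · rw [i5, word_cons, List.sum_cons, cut_single, Multiset.add_cons, h10,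
            ← Multiset.singleton_add]
          abel
      · obtain ⟨w', i1, i2, i3, i4, i5⟩ := exists_insert_token (K := K) h1 p n f
        refine ⟨w', z, ls', _, i1, h2, i2 (fun f => u < f ∧ f < 1) ⟨h, hf⟩ h3, h4, hwO, hO, ?_,
          _root_.trans h8 i4, h9, ?_⟩
        · rw [i3, Multiset.cons_add, Multiset.cons_add, h7, Multiset.cons_add]
        · rw [i5, word_cons, List.sum_cons, cut_single, Multiset.cons_add, h10,
            ← Multiset.singleton_add]
          abel

/-- The bound `u` is doubled because the last low layer may sit exactly at `u` while the abstract
step puts new layers behind it. The high layers already lie in an open interval, so `v` does not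
change. -/
lemma AFire.exists_marking {t : Transition Q P} {B B' : AMarking P K} (h : AFire t B B')
    (harcs : ∀ a ∈ t.inputs + t.reads + t.outputs, a.2.maxBound ≤ K) {u v : ℝ≥0} {M : Marking P}
    (hM : Rep K u v M B) (hu : 0 < u) (hu1 : 2 * u ≤ 1) (hv : v < 1) :
    ∃ I R O rest : Marking P, M = I + R + rest ∧ Match I t.inputs ∧ Match R t.reads ∧
      Match O t.outputs ∧ Rep K (2 * u) v (O + R + rest) B' := by
  obtain ⟨hs, z, ls, rfl, rfl, hhs, hls, hhs', hls'⟩ := hM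
  obtain ⟨H, L, z', Ohat, Ozero, cH, cL, h1, h2, h3, h4, h5, h6, h7, rfl⟩ := h
  obtain ⟨SH, rfl, rfl⟩ := exists_word_eq_map_total h1
  obtain ⟨SL, rfl, rfl⟩ := exists_word_eq_map_total h3
  obtain ⟨s, rfl, rfl⟩ := exists_cut_eq_total h2
  have huu : u < 2 * u := by linarith
  rw [increasing_part] at hhs hls
  rw [forall_mem_part (p := fun f => v < f ∧ f < 1)] at hhs'
  rw [forall_mem_part (p := fun f => 0 < f ∧ f ≤ u)] at hls'
  have hSH : ∀ s ∈ SH, 0 < s.1 ∧ s.1 < 1 := fun s hs =>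
    ⟨zero_le.trans_lt (hhs' s hs).1, (hhs' s hs).2⟩
  have hSL : ∀ s ∈ SL, 0 < s.1 ∧ s.1 < 2 * u := fun s hs =>
    ⟨(hls' s hs).1, (hls' s hs).2.trans_lt huu⟩
  have hSL1 : ∀ s ∈ SL, 0 < s.1 ∧ s.1 < 1 := fun s hs =>
    ⟨(hSL s hs).1, (hSL s hs).2.trans_le hu1⟩
  rw [map_kept_splits] at h5 h6 h7
  rw [map_kept_splits] at h7
  obtain ⟨wH, eH, a1, a2, a3, a4, a5, a6⟩ := exists_extension hv (increasing_part.2 hhs)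
    (forall_mem_part (p := fun f => v < f ∧ f < 1).2 hhs') h5
  obtain ⟨wL, eL, b1, b2, b3, b4, b5, b6⟩ := exists_extension (hu.trans huu) (increasing_part.2 hls)
    (forall_mem_part (p := fun f => 0 < f ∧ f < 2 * u).2 hSL) h6
  -- Both sides of the sum condition in `AFire` contain the kept tokens; cancelling them identifies
  -- `Ohat` with the added tokens.
  have hO : Ohat = (word K eH).sum + (word K eL).sum := by
    rw [a6, b6] at h7
    refine (add_left_cancel (a := (word K (part LayerSplit.kept SH)).sum +
      (word K (part LayerSplit.kept SL)).sum) (Eq.trans ?_ h7)).symm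
    abel
  -- One value of `e` suffices, since all fractional parts in `(0, 1)` are equivalent for the arcs.
  obtain ⟨e, he, he1⟩ := exists_between (zero_lt_one (α := ℝ≥0))
  obtain ⟨m1, m2, m3⟩ := h4 e he he1
  have inside : ∀ g : LayerSplit P → Multiset (P × ℕ),
      SameRegions K (conc (part g SH) + place 0 (g s) + conc (part g SL))
        (shift e ((word K (part g SH)).sum + (word K (part g SL)).sum) + shift 0 (cut K (g s))) :=
    fun g => sameRegions_layers he he1 _ (forall_mem_part (p := fun f => 0 < f ∧ f < 1).2 hSH)
      (forall_mem_part (p := fun f => 0 < f ∧ f < 1).2 hSL1)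
  rw [map_inp_splits, map_inp_splits] at m1
  rw [map_read_splits, map_read_splits] at m2
  refine ⟨conc (part LayerSplit.inp SH) + place 0 s.inp + conc (part LayerSplit.inp SL),
    conc (part LayerSplit.read SH) + place 0 s.read + conc (part LayerSplit.read SL),
    conc eH + place 0 (lift Ozero) + conc eL,
    conc (part LayerSplit.rest SH) + place 0 s.rest + conc (part LayerSplit.rest SL),
    ?_, ?_, ?_, ?_, ?_⟩
  · rw [conc_part_total, conc_part_total, LayerSplit.total, place_add, place_add]; abel
  · exact (inside _).symm.match (fun a ha => harcs a (by simp [ha])) m1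
  · exact (inside _).symm.match (fun a ha => harcs a (by simp [ha])) m2
  · refine SameRegions.match (SameRegions.symm ?_) (fun a ha => harcs a (by simp [ha])) m3
    have := sameRegions_layers (K := K) he he1 (hs := eH) (ls := eL) (lift Ozero)
      (fun l hl => ⟨zero_le.trans_lt (a3 l hl).1, (a3 l hl).2⟩)
      (fun l hl => ⟨(b3 l hl).1, (b3 l hl).2.trans_le hu1⟩)
    rwa [cut_lift, ← hO] at this
  · refine ⟨dropEmpty wH, s.kept + lift Ozero, dropEmpty wL, ?_, ?_, a1.dropEmpty, b1.dropEmpty,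
      fun l hl => a2 l (mem_of_mem_dropEmpty hl), fun l hl => ?_⟩
    · rw [conc_dropEmpty, conc_dropEmpty, a5, b5, conc_part_kept, conc_part_kept, place_add,
        LayerSplit.kept, place_add]
      abel
    · simp [a4, b4]
    · exact ⟨(b2 l (mem_of_mem_dropEmpty hl)).1, (b2 l (mem_of_mem_dropEmpty hl)).2.le⟩

lemma exists_aFire {t : Transition Q P} {B : AMarking P K}
    (harcs : ∀ a ∈ t.inputs + t.reads + t.outputs, a.2.maxBound ≤ K) {u : ℝ≥0} (hu : u < 1)
    {I R O rest : Marking P} (hM : Rep K u u (I + R + rest) B)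
    (hI : Match I t.inputs) (hR : Match R t.reads) (hO : Match O t.outputs) :
    ∃ B', AFire t B B' ∧ B'.Reduced ∧ Rep K u u (O + R + rest) B' := by
  obtain ⟨hs, z, ls, hM, rfl, hhs, hls, hhs', hls'⟩ := hM
  obtain ⟨x, i, y, x', i', y', h1, h2, rfl, rfl, rfl⟩ := exists_refinement₃ (hM.symm)
  obtain ⟨a, b, c, a', b', c', h3, h4, rfl, rfl, rfl⟩ := exists_refinement₃ h1
  obtain ⟨SH, rfl, rfl, rfl, rfl⟩ := exists_conc_eq_add h3
  obtain ⟨s, rfl, rfl, rfl, rfl⟩ := exists_place_eq_add h4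
  obtain ⟨SL, rfl, rfl, rfl, rfl⟩ := exists_conc_eq_add h2
  rw [increasing_part] at hhs hls
  rw [forall_mem_part (p := fun f => u < f ∧ f < 1)] at hhs'
  rw [forall_mem_part (p := fun f => 0 < f ∧ f ≤ u)] at hls'
  have hSH : ∀ s ∈ SH, 0 < s.1 ∧ s.1 < 1 := fun s hs =>
    ⟨zero_le.trans_lt (hhs' s hs).1, (hhs' s hs).2⟩
  have hSL : ∀ s ∈ SL, 0 < s.1 ∧ s.1 < 1 := fun s hs =>
    ⟨(hls' s hs).1, (hls' s hs).2.trans_lt hu⟩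
  have inside : ∀ (g : LayerSplit P → Multiset (P × ℕ)) (e : ℝ≥0), 0 < e → e < 1 →
      SameRegions K (conc (part g SH) + place 0 (g s) + conc (part g SL))
        (shift e ((word K (part g SH)).sum + (word K (part g SL)).sum) + shift 0 (cut K (g s))) :=
    fun g e he he1 => sameRegions_layers he he1 _
      (forall_mem_part (p := fun f => 0 < f ∧ f < 1).2 hSH)
      (forall_mem_part (p := fun f => 0 < f ∧ f < 1).2 hSL)
  obtain ⟨wH, zO, wL, wO, a1, a2, a3, a4, a5, a6, a7, a8, a9, a10⟩ :=
    exists_add_marking (K := K) (increasing_part (g := LayerSplit.kept).2 hhs)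
      (increasing_part (g := LayerSplit.kept).2 hls)
      (forall_mem_part (p := fun f => u < f ∧ f < 1).2 hhs')
      (forall_mem_part (p := fun f => 0 < f ∧ f ≤ u).2 hls') O
  refine ⟨⟨reduce (word K wH), cut K s.kept + cut K zO, reduce (word K wL)⟩,
    ⟨splits K SH, splits K SL, s.toSplit K, (word K wO).sum, cut K zO, word K wH, word K wL,
      (map_total_splits _).symm, (s.toSplit_total).symm, (map_total_splits _).symm, ?_, ?_, ?_, ?_,
      ?_⟩, ⟨fun b hb => (mem_reduce.1 hb).2, fun b hb => (mem_reduce.1 hb).2⟩,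
    dropEmpty wH, s.kept + zO, dropEmpty wL, ?_, by simp, a1.dropEmpty, a2.dropEmpty,
      fun l hl => a3 l (mem_of_mem_dropEmpty hl), fun l hl => a4 l (mem_of_mem_dropEmpty hl)⟩
  · intro e he he1
    refine ⟨?_, ?_, ?_⟩
    · rw [map_inp_splits, map_inp_splits]
      exact (inside LayerSplit.inp e he he1).match (fun a ha => harcs a (by simp [ha])) hI
    · rw [map_read_splits, map_read_splits]
      exact (inside LayerSplit.read e he he1).match (fun a ha => harcs a (by simp [ha])) hR
    · have := (sameRegions_conc (K := K) he he1 a5).add (sameRegions_place_zero zO)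
      rw [← a6] at this
      exact this.match (fun a ha => harcs a (by simp [ha])) hO
  · rwa [map_kept_splits]
  · rwa [map_kept_splits]
  · rwa [map_kept_splits, map_kept_splits]
  · simp
  · rw [conc_dropEmpty, conc_dropEmpty, place_add]
    have : conc wH + (place 0 s.kept + place 0 zO) + conc wL =
        place 0 s.kept + (conc wH + place 0 zO + conc wL) := by abel
    rw [this, a7, conc_part_kept, conc_part_kept, LayerSplit.kept, place_add]
    abel

end Fire

/-! ## Timed steps -/

section Delay

variable {P : Type*} {K : ℕ}

lemma Rep.mono {u v u' v' : ℝ≥0} (hu : u ≤ u') (hv : v' ≤ v) {M : Marking P} {B : AMarking P K}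
    (h : Rep K u v M B) : Rep K u' v' M B := by
  obtain ⟨hs, z, ls, rfl, rfl, hhs, hls, hhs', hls'⟩ := h
  exact ⟨hs, z, ls, rfl, rfl, hhs, hls, fun l hl => ⟨hv.trans_lt (hhs' l hl).1, (hhs' l hl).2⟩,
    fun l hl => ⟨(hls' l hl).1, (hls' l hl).2.trans hu⟩⟩

lemma reduce_cut (x : ℝ≥0) (z : Multiset (P × ℕ)) :
    reduce [cut K z] = word K (dropEmpty [(x, z)]) := by simp

/-- The low layers after a delay by `x`: the tokens `z` with integral ages become the
first layer. -/
lemma low_layers_delay {u x : ℝ≥0} (hx : 0 < x) {z : Multiset (P × ℕ)} {ls : List (Layer P)}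
    (hls : Increasing ls) (hls' : ∀ l ∈ ls, 0 < l.1 ∧ l.1 ≤ u) :
    Increasing (dropEmpty [(x, z)] ++ shiftLayers x ls) ∧
      ∀ l ∈ dropEmpty [(x, z)] ++ shiftLayers x ls, 0 < l.1 ∧ l.1 ≤ u + x := by
  have hz : ∀ l ∈ dropEmpty [(x, z)], l.1 = x := fun l hl => by
    rw [List.mem_singleton.1 (mem_of_mem_dropEmpty hl)]
  refine ⟨List.pairwise_append.2 ⟨Increasing.dropEmpty (List.pairwise_singleton _ _),
    hls.shiftLayers x, ?_⟩, ?_⟩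
  · intro a ha b hb
    obtain ⟨l, hl, rfl⟩ := List.mem_map.1 hb
    rw [hz a ha]
    simpa using (hls' l hl).1
  · intro l hl
    rcases List.mem_append.1 hl with hl | hl
    · rw [hz l hl]
      exact ⟨hx, le_add_self⟩
    · obtain ⟨l, hm, rfl⟩ := List.mem_map.1 hl
      exact ⟨add_pos (hls' l hm).1 hx, by simpa using (hls' l hm).2⟩

lemma conc_dropEmpty_singleton (x : ℝ≥0) (z : Multiset (P × ℕ)) :
    conc (dropEmpty [(x, z)]) = delay x (place 0 z) := by
  simp [delay_place]

/-- The delay of type 1: it ends before the first high layer reaches an integer, so only the tokens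
of integral age change their place in the word. -/
lemma rep_delay {u v x : ℝ≥0} (hx : 0 < x) {hs ls : List (Layer P)} {z : Multiset (P × ℕ)}
    (hhs : Increasing hs) (hls : Increasing ls) (hhs' : ∀ l ∈ hs, v < l.1 ∧ l.1 + x < 1)
    (hls' : ∀ l ∈ ls, 0 < l.1 ∧ l.1 ≤ u) :
    Rep K (u + x) (v + x) (delay x (conc hs + place 0 z + conc ls))
      ⟨word K hs, 0, reduce [cut K z] ++ word K ls⟩ := by
  obtain ⟨h1, h2⟩ := low_layers_delay (z := z) hx hls hls'
  refine ⟨shiftLayers x hs, 0, dropEmpty [(x, z)] ++ shiftLayers x ls, ?_, ?_,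
    hhs.shiftLayers x, h1, ?_, h2⟩
  · rw [conc_append, conc_dropEmpty_singleton, conc_shiftLayers, conc_shiftLayers]
    simp [add_assoc]
  · rw [word_append, word_shiftLayers, word_shiftLayers, reduce_cut x, cut_zero]
  · intro l hl
    obtain ⟨l, hm, rfl⟩ := List.mem_map.1 hl
    exact ⟨by simpa using (hhs' l hm).1, (hhs' l hm).2⟩

/-- The delay ends exactly when the last high layer becomes integral, which is type 1 followed by
type 2. -/
lemma rep_delay_of_add_eq_one {u v x f : ℝ≥0} (hx : 0 < x) (hf : f + x = 1)
    {hs ls : List (Layer P)} {z b : Multiset (P × ℕ)}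
    (hhs : Increasing hs) (hls : Increasing ls) (hhs' : ∀ l ∈ hs, v < l.1 ∧ l.1 < f)
    (hls' : ∀ l ∈ ls, 0 < l.1 ∧ l.1 ≤ u) :
    Rep K (u + x) (v + x) (delay x (conc (hs ++ [(f, b)]) + place 0 z + conc ls))
      ⟨word K hs, succAge (cut K b), reduce [cut K z] ++ word K ls⟩ := by
  obtain ⟨h1, h2⟩ := low_layers_delay (z := z) hx hls hls'
  have hb : place 0 (older b) = delay x (place f b) := by
    rw [delay_place, hf, ← place_add_one, zero_add]
  refine ⟨shiftLayers x hs, older b, dropEmpty [(x, z)] ++ shiftLayers x ls, ?_, ?_,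
    hhs.shiftLayers x, h1, ?_, h2⟩
  · rw [conc_append, conc_append, conc_dropEmpty_singleton, conc_shiftLayers, conc_shiftLayers, hb]
    simp [add_assoc]
  · rw [word_append, word_shiftLayers, word_shiftLayers, reduce_cut x, cut_older]
  · intro l hl
    obtain ⟨l, hm, rfl⟩ := List.mem_map.1 hl
    exact ⟨by simpa using (hhs' l hm).1, hf ▸ by simpa using (hhs' l hm).2⟩

/-- The common core of types 3 and 4. A delay by `1 - y` moves every position back by `y` modulo
one: layers below `y` and the integral tokens end up high, those above `y` stay low one unit older,
and a layer at `y` becomes integral. Taking `b = 0` gives type 3. -/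
lemma rep_delay_wrap {u v x y : ℝ≥0} (hxy : y + x = 1) (hx1 : x < 1) (hvx : v < x)
    {hs l₁ l₂ : List (Layer P)} {z b : Multiset (P × ℕ)}
    (hhs : Increasing hs) (hl₁ : Increasing l₁) (hl₂ : Increasing l₂)
    (hhs' : ∀ l ∈ hs, v + y < l.1 ∧ l.1 < 1) (hl₁' : ∀ l ∈ l₁, 0 < l.1 ∧ l.1 < y)
    (hl₂' : ∀ l ∈ l₂, y < l.1 ∧ l.1 ≤ u + y) :
    Rep K u v (delay x (conc hs + place 0 z + (conc l₁ + place y b + conc l₂)))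
      ⟨(word K hs).map succAge ++ reduce [cut K z] ++ word K l₁, succAge (cut K b),
        (word K l₂).map succAge⟩ := by
  have hb : place 0 (older b) = delay x (place y b) := by
    rw [delay_place, hxy, ← place_add_one, zero_add]
  have hz : ∀ l ∈ dropEmpty [(x, z)], l.1 = x := fun l hl => by
    rw [List.mem_singleton.1 (mem_of_mem_dropEmpty hl)]
  have e1 : ∀ l ∈ hs, 1 ≤ l.1 + x := fun l hl => by
    have := (hhs' l hl).1
    have h0 : 0 ≤ v := zero_le
    rw [← hxy]; gcongr; exact le_add_self.trans this.le
  have e2 : ∀ l ∈ l₂, 1 ≤ l.1 + x := fun l hl => by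
    rw [← hxy]; gcongr; exact (hl₂' l hl).1.le
  refine ⟨wrapLayers x hs ++ dropEmpty [(x, z)] ++ shiftLayers x l₁, older b, wrapLayers x l₂,
    ?_, ?_, ?_, hl₂.wrapLayers e2, ?_, ?_⟩
  · rw [conc_append, conc_append, conc_dropEmpty_singleton, conc_shiftLayers, conc_wrapLayers e1,
      conc_wrapLayers e2, hb]
    simp [add_assoc]
  · rw [word_append, word_append, word_shiftLayers, word_wrapLayers, word_wrapLayers, reduce_cut x,
      cut_older]
  · refine List.pairwise_append.2 ⟨List.pairwise_append.2 ⟨hhs.wrapLayers e1,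
      Increasing.dropEmpty (List.pairwise_singleton _ _), ?_⟩, hl₁.shiftLayers x, ?_⟩
    · intro a ha c hc
      obtain ⟨l, hl, rfl⟩ := List.mem_map.1 ha
      rw [hz c hc]
      refine (tsub_lt_iff_right (e1 l hl)).2 ?_
      rw [add_comm x]; gcongr; exact (hhs' l hl).2
    · intro a ha c hc
      obtain ⟨l', hl', rfl⟩ := List.mem_map.1 hc
      have hpos := (hl₁' l' hl').1
      have : x < l'.1 + x := by simpa using hpos
      rcases List.mem_append.1 ha with ha | ha
      · obtain ⟨l, hl, rfl⟩ := List.mem_map.1 ha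
        refine lt_of_le_of_lt ((tsub_le_iff_right).2 ?_) this
        rw [add_comm x]; gcongr; exact (hhs' l hl).2.le
      · rwa [hz a ha]
  · intro l hl
    rcases List.mem_append.1 hl with hl | hl
    · rcases List.mem_append.1 hl with hl | hl
      · obtain ⟨l, hm, rfl⟩ := List.mem_map.1 hl
        obtain ⟨h1, h2⟩ := hhs' l hm
        refine ⟨lt_tsub_iff_right.2 ?_, (tsub_lt_iff_right (e1 l hm)).2 ?_⟩
        · rw [← hxy, ← add_assoc]; gcongr
        · exact add_lt_add h2 hx1
      · rw [hz l hl]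
        exact ⟨hvx, hx1⟩
    · obtain ⟨l, hm, rfl⟩ := List.mem_map.1 hl
      obtain ⟨h1, h2⟩ := hl₁' l hm
      refine ⟨hvx.trans (by simpa using h1), ?_⟩
      exact (add_lt_add_of_lt_of_le h2 le_rfl).trans_eq hxy
  · intro l hl
    obtain ⟨l, hm, rfl⟩ := List.mem_map.1 hl
    obtain ⟨h1, h2⟩ := hl₂' l hm
    refine ⟨tsub_pos_iff_lt.2 ?_, tsub_le_iff_right.2 ?_⟩
    · rw [← hxy]; gcongr
    · rw [← hxy, ← add_assoc]; gcongr

lemma exists_separator {lo hi : ℝ≥0} (h : lo < hi) {l₁ l₂ : List (Layer P)}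
    (hl : Increasing (l₁ ++ l₂)) (hl' : ∀ l ∈ l₁ ++ l₂, lo < l.1 ∧ l.1 < hi) :
    ∃ y, lo < y ∧ y < hi ∧ (∀ l ∈ l₁, l.1 < y) ∧ ∀ l ∈ l₂, y < l.1 := by
  induction l₁ generalizing lo with
  | nil =>
    obtain ⟨f, h1, h2, h3⟩ := exists_below h fun l hl => (hl' l hl).1
    exact ⟨f, h1, h2, by simp, h3⟩
  | cons l l₁ ih =>
    obtain ⟨h1, h2⟩ := List.pairwise_cons.1 hl
    simp only [List.cons_append, List.mem_cons, forall_eq_or_imp] at hl'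
    obtain ⟨y, h3, h4, h5, h6⟩ := ih hl'.1.2 h2 fun l hl => ⟨h1 l hl, (hl'.2 l hl).2⟩
    exact ⟨y, hl'.1.1.trans h3, h4, by simpa [h3] using h5, h6⟩

lemma exists_small_delay {w : List (Layer P)} (hw : ∀ l ∈ w, l.1 < 1) {d : ℝ≥0} (hd : 0 < d) :
    ∃ x, 0 < x ∧ x < d ∧ ∀ l ∈ w, l.1 + x < 1 := by
  induction w with
  | nil =>
    obtain ⟨x, h1, h2⟩ := exists_between hd
    exact ⟨x, h1, h2, by simp⟩
  | cons l w ih =>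
    simp only [List.mem_cons, forall_eq_or_imp] at hw
    obtain ⟨x, h1, h2, h3⟩ := ih hw.2
    obtain ⟨y, h4, h5⟩ := exists_between (lt_min h1 (tsub_pos_of_lt hw.1))
    rw [lt_min_iff] at h5
    refine ⟨y, h4, h5.1.trans h2, ?_⟩
    simp only [List.mem_cons, forall_eq_or_imp]
    exact ⟨lt_tsub_iff_left.1 h5.2, fun l hl => lt_trans (by gcongr; exact h5.1) (h3 l hl)⟩

end Delay

/-! ## Simulation of the abstract net -/

/-- A high layer above `1 - δ` moves back by `y ≤ 2 * δ`, hence the new bound `1 - 3 * δ`. The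
choice of `y` up to `2 * δ`, and not only up to `δ`, leaves room for a cut behind a layer at `δ`. -/
lemma rep_delay_wrap_of_small {P : Type*} {K : ℕ} {δ y : ℝ≥0} (hδ : 0 < δ) (hδ1 : δ ≤ 1 / 8)
    (hy0 : 0 < y) (hy : y ≤ 2 * δ) {hs l₁ l₂ : List (Layer P)} {z b : Multiset (P × ℕ)}
    (hhs : Increasing hs) (hl : Increasing (l₁ ++ l₂)) (hhs' : ∀ l ∈ hs, 1 - δ < l.1 ∧ l.1 < 1)
    (hl' : ∀ l ∈ l₁ ++ l₂, 0 < l.1 ∧ l.1 ≤ δ) (hl₁ : ∀ l ∈ l₁, l.1 < y) (hl₂ : ∀ l ∈ l₂, y < l.1) :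
    Rep K (3 * δ) (1 - 3 * δ)
      (delay (1 - y) (conc hs + place 0 z + (conc l₁ + place y b + conc l₂)))
      ⟨(word K hs).map succAge ++ reduce [cut K z] ++ word K l₁, succAge (cut K b),
        (word K l₂).map succAge⟩ := by
  -- These identities let linear arithmetic see through the truncated subtraction.
  have h1 : 1 - δ + δ = 1 := tsub_add_cancel_of_le (by linarith)
  have h3 : 1 - 3 * δ + 3 * δ = 1 := tsub_add_cancel_of_le (by linarith)
  have hxy : y + (1 - y) = 1 := add_tsub_cancel_of_le (by linarith)
  obtain ⟨hi₁, hi₂, -⟩ := List.pairwise_append.1 hl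
  refine rep_delay_wrap hxy (tsub_lt_self one_pos hy0) (by linarith) hhs hi₁ hi₂ ?_ ?_ ?_
  · exact fun l hl => ⟨by linarith [(hhs' l hl).1], (hhs' l hl).2⟩
  · exact fun l hl => ⟨(hl' l (by simp [hl])).1, hl₁ l hl⟩
  · exact fun l hl => ⟨hl₂ l hl, by linarith [(hl' l (by simp [hl])).2]⟩

namespace PTPN

variable {Q P : Type*} (N : PTPN Q P)

lemma AStep.simulate {c c' : N.AConf} {s : ℝ≥0} (h : N.AStep c s c') {ε : ℝ≥0} (hε : 0 < ε) :
    ∃ d > 0, ∀ δ, 0 < δ → δ ≤ d → ∀ M, Rep N.cmax δ (1 - δ) M c.2 →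
      ∃ M' s', s' ≤ s + ε ∧ N.Step (c.1, M) s' (c'.1, M') ∧
        Rep N.cmax (3 * δ) (1 - 3 * δ) M' c'.2 := by
  set S : ℝ≥0 := ((N.storageCost c.2.tokens : ℕ) : ℝ≥0) with hS
  have hS1 : 0 < S + 1 := by positivity
  -- `1 / 8` keeps the subtractions from `1` exact, and `ε / (S + 1)` makes storage during a delay
  -- of at most `δ` cost at most `ε`; the `+ 1` covers `S = 0`.
  refine ⟨min (1 / 8) (ε / (S + 1)), lt_min (by norm_num) (by positivity), fun δ hδ hd M hM => ?_⟩
  rw [le_min_iff] at hd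
  obtain ⟨hd, hd'⟩ := hd
  have hstore : (N.storageCost M : ℝ≥0) = S := by rw [hS, hM.storageCost_eq]
  have hcost : ∀ x ≤ δ, x * S ≤ ε := fun x hx => calc
    x * S ≤ ε / (S + 1) * (S + 1) := by gcongr; exacts [hx.trans hd', le_self_add]
    _ = ε := div_mul_cancel₀ _ hS1.ne'
  have h3 : 1 - 3 * δ ≤ 1 - δ := tsub_le_tsub_left (by linarith) _
  cases h with
  | disc t B B' h =>
    obtain ⟨I, R, O, rest, rfl, hI, hR, hO, hrep⟩ := h.exists_marking
      (fun a ha => N.maxBound_le_cmax t.2 ha) hM hδ (by linarith) (tsub_lt_self one_pos hδ)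
    exact ⟨_, _, le_self_add, .disc t I R O rest hI hR hO, hrep.mono (by linarith) h3⟩
  | type1 q B hB =>
    obtain ⟨hs, z, ls, rfl, rfl, hhs, hls, hhs', hls'⟩ := hM
    obtain ⟨x, hx, hxδ, hx1⟩ := exists_small_delay (fun l hl => (hhs' l hl).2) hδ
    refine ⟨_, _, ?_, .time q _ x hx,
      (rep_delay hx hhs hls (fun l hl => ⟨(hhs' l hl).1, hx1 l hl⟩) hls').mono (by linarith)
        (h3.trans le_self_add)⟩
    rw [hstore]
    simpa using hcost x hxδ.le
  | type2 q h l b hB =>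
    obtain ⟨hs, z, ls, rfl, hB', hhs, hls, hhs', hls'⟩ := hM
    simp only [AMarking.mk.injEq] at hB'
    obtain ⟨h1, h2, rfl⟩ := hB'
    obtain rfl : z = 0 := cut_eq_zero.1 h2.symm
    obtain ⟨hs, w, rfl, rfl, hw⟩ := List.map_eq_append_iff.1 h1.symm
    obtain ⟨⟨f, b⟩, rfl, rfl⟩ := List.map_eq_singleton_iff.1 hw
    obtain ⟨hhs, -, hlt⟩ := List.pairwise_append.1 hhs
    have hf := hhs' (f, b) (by simp)
    have hx : 0 < 1 - f := tsub_pos_of_lt hf.2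
    have hxδ : 1 - f ≤ δ := tsub_le_iff_tsub_le.1 hf.1.le
    have := rep_delay_of_add_eq_one (K := N.cmax) (z := 0) (b := b) hx
      (add_tsub_cancel_of_le hf.2.le) hhs hls
      (fun l hl => ⟨(hhs' l (by simp [hl])).1, hlt l hl (f, b) (by simp)⟩) hls'
    have hrep := this.mono (u' := 3 * δ) (v' := 1 - 3 * δ) (by linarith) (h3.trans le_self_add)
    refine ⟨_, _, ?_, .time q _ _ hx, ?_⟩
    · rw [hstore]
      simpa using hcost _ hxδ
    · simpa [reduce, word] using hrep
  | type3 q h l₁ l₂ b₀ hB =>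
    obtain ⟨hs, z, ls, rfl, hB', hhs, hls, hhs', hls'⟩ := hM
    simp only [AMarking.mk.injEq] at hB'
    obtain ⟨rfl, rfl, h2⟩ := hB'
    obtain ⟨w₁, w₂, rfl, rfl, rfl⟩ := List.map_eq_append_iff.1 h2.symm
    -- Type 3 makes no layer integral, so `y` is chosen strictly between the two parts of the low
    -- word; in type 4 it is the position of the layer `b` itself.
    obtain ⟨y, hy0, hy1, hw₁, hw₂⟩ := exists_separator (show 0 < 2 * δ by linarith) hls
      fun l hl => ⟨(hls' l hl).1, (hls' l hl).2.trans_lt (by linarith)⟩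
    have := rep_delay_wrap_of_small (K := N.cmax) hδ hd hy0 hy1.le (b := 0) hhs hls hhs' hls'
      hw₁ hw₂ (z := z)
    have hx : 0 < 1 - y := tsub_pos_of_lt (by linarith)
    refine ⟨_, _, ?_, .time q _ _ hx, ?_⟩
    · rw [hstore]
      exact (mul_le_of_le_one_left' tsub_le_self).trans le_self_add
    · simpa [word, succAge_eq_zero.2 rfl] using this
  | type4 q h l₁ l₂ b₀ b hB =>
    obtain ⟨hs, z, ls, rfl, hB', hhs, hls, hhs', hls'⟩ := hM
    simp only [AMarking.mk.injEq] at hB'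
    obtain ⟨rfl, rfl, h2⟩ := hB'
    obtain ⟨w₁, w, rfl, rfl, hw⟩ := List.map_eq_append_iff.1 h2.symm
    obtain ⟨⟨y, b⟩, w₂, rfl, rfl, rfl⟩ := List.map_eq_cons_iff.1 hw
    have hy := hls' (y, b) (by simp)
    obtain ⟨hw₁, hw₂, hlt⟩ := List.pairwise_append.1 hls
    obtain ⟨hlt', hw₂⟩ := List.pairwise_cons.1 hw₂
    have := rep_delay_wrap_of_small (K := N.cmax) hδ hd hy.1 (hy.2.trans (by linarith)) (b := b)
      (l₁ := w₁) (l₂ := w₂) hhs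
      (List.pairwise_append.2 ⟨hw₁, hw₂, fun a ha c hc => hlt a ha c (by simp [hc])⟩) hhs'
      (fun l hl => hls' l (by simp only [List.mem_append, List.mem_cons] at hl ⊢; tauto))
      (fun l hl => hlt l hl _ (by simp)) hlt' (z := z)
    have hx : 0 < 1 - y := tsub_pos_of_lt (by linarith [hy.2])
    refine ⟨_, _, ?_, .time q _ _ hx, ?_⟩
    · rw [hstore]
      exact (mul_le_of_le_one_left' tsub_le_self).trans le_self_add
    · simpa [word, add_assoc] using this

/-- The threshold `d` is built backwards from the end of the computation, and the error budget is
halved at each step. -/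
lemma exists_comp_of_abstract {c c' : N.AConf} {r : ℝ≥0} (h : Comp N.AStep c r c') {ε : ℝ≥0}
    (hε : 0 < ε) : ∃ d > 0, ∀ δ, 0 < δ → δ ≤ d → ∀ M, Rep N.cmax δ (1 - δ) M c.2 →
      ∃ M' r', r' ≤ r + ε ∧ Comp N.Step (c.1, M) r' (c'.1, M') := by
  induction h generalizing ε with
  | refl c => exact ⟨1, one_pos, fun δ _ _ M _ => ⟨M, 0, zero_le, .refl _⟩⟩
  | @cons _ _ _ s r h _ ih =>
    obtain ⟨d₁, hd₁, h₁⟩ := AStep.simulate N h (half_pos hε)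
    obtain ⟨d₂, hd₂, h₂⟩ := ih (half_pos hε)
    -- The first step turns `δ` into `3 * δ`, which must still be admissible for the rest.
    refine ⟨min d₁ (d₂ / 3), lt_min hd₁ (by positivity), fun δ hδ hd M hM => ?_⟩
    rw [le_min_iff] at hd
    obtain ⟨M₁, s', hs', hstep, hM₁⟩ := h₁ δ hδ hd.1 M hM
    obtain ⟨M₂, r', hr', hcomp⟩ := h₂ (3 * δ) (by positivity) (by linarith [hd.2]) M₁ hM₁
    refine ⟨M₂, s' + r', ?_, .cons hstep hcomp⟩
    calc s' + r' ≤ (s + ε / 2) + (r + ε / 2) := add_le_add hs' hr'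
      _ = s + r + ε := by rw [add_add_add_comm, add_halves]

end PTPN

/-! ## Every reduced abstract marking is an abstraction -/

section Realization

variable {P : Type*} {K : ℕ}

lemma fract_natCast_add_coe (n : ℕ) {f : ℝ≥0} (hf : f < 1) :
    Int.fract (((n : ℝ≥0) + f : ℝ≥0) : ℝ) = f := by
  rw [NNReal.coe_add, NNReal.coe_natCast, Int.fract_natCast_add, Int.fract_eq_self]
  exact ⟨f.2, by exact_mod_cast hf⟩

lemma floor_natCast_add_coe (n : ℕ) {f : ℝ≥0} (hf : f < 1) :
    ⌊(((n : ℝ≥0) + f : ℝ≥0) : ℝ)⌋₊ = n := by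
  have h0 : (0 : ℝ) ≤ f := f.2
  have h1 : (f : ℝ) < 1 := by exact_mod_cast hf
  rw [Nat.floor_eq_iff (NNReal.coe_nonneg _)]
  push_cast
  constructor <;> linarith

lemma mem_conc {w : List (Layer P)} {a : P × ℝ≥0} :
    a ∈ conc w ↔ ∃ l ∈ w, ∃ c ∈ l.2, (c.1, (c.2 : ℝ≥0) + l.1) = a := by
  induction w with
  | nil => simp
  | cons l w ih => rw [conc_cons, Multiset.mem_add, ih, place, Multiset.mem_map]; simp

lemma mem_fracs_conc {w : List (Layer P)} (hw : ∀ l ∈ w, l.1 < 1) {g : ℝ} :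
    g ∈ fracs (conc w) ↔ ∃ l ∈ w, l.2 ≠ 0 ∧ (l.1 : ℝ) = g := by
  simp only [fracs, Multiset.mem_toFinset, Multiset.mem_map, mem_conc]
  constructor
  · rintro ⟨_, ⟨l, hl, c, hc, rfl⟩, rfl⟩
    exact ⟨l, hl, fun h => by simp [h] at hc, (fract_natCast_add_coe c.2 (hw l hl)).symm⟩
  · rintro ⟨l, hl, hne, rfl⟩
    obtain ⟨c, hc⟩ := Multiset.exists_mem_of_ne_zero hne
    exact ⟨_, ⟨l, hl, c, hc, rfl⟩, fract_natCast_add_coe c.2 (hw l hl)⟩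

lemma fracPart_add (M M' : Marking P) (g : ℝ) :
    fracPart K (M + M') g = fracPart K M g + fracPart K M' g := by
  simp [fracPart, Multiset.filter_add]

lemma fracPart_place {f : ℝ≥0} (hf : f < 1) (b : Multiset (P × ℕ)) :
    fracPart K (place f b) f = cut K b := by
  rw [fracPart, Multiset.filter_eq_self.2]
  · simp only [place, cut, Multiset.map_map, Function.comp_def, floor_natCast_add_coe _ hf]
  · intro a ha
    obtain ⟨c, -, rfl⟩ := Multiset.mem_map.1 ha
    exact fract_natCast_add_coe c.2 hf

lemma fracPart_conc_of_forall_ne {w : List (Layer P)} (hw : ∀ l ∈ w, l.1 < 1) {f : ℝ≥0}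
    (hf : ∀ l ∈ w, l.1 ≠ f) : fracPart K (conc w) f = 0 := by
  rw [fracPart, Multiset.filter_eq_nil.2, Multiset.map_zero]
  intro a ha h
  obtain ⟨l, hl, c, hc, rfl⟩ := mem_conc.1 ha
  rw [fract_natCast_add_coe c.2 (hw l hl)] at h
  exact hf l hl (by exact_mod_cast h)

lemma fracPart_conc {w : List (Layer P)} (hw : ∀ l ∈ w, l.1 < 1)
    (hne : w.Pairwise fun l l' => l.1 ≠ l'.1) {l : Layer P} (hl : l ∈ w) :
    fracPart K (conc w) l.1 = cut K l.2 := by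
  induction w with
  | nil => simp at hl
  | cons l' w ih =>
    obtain ⟨h1, h2⟩ := List.pairwise_cons.1 hne
    simp only [List.mem_cons, forall_eq_or_imp] at hw
    rw [conc_cons, fracPart_add]
    rcases List.mem_cons.1 hl with rfl | hl
    · rw [fracPart_place hw.1, fracPart_conc_of_forall_ne hw.2 fun l' hl' => (h1 l' hl').symm,
        add_zero]
    · rw [ih hw.2 h2 hl]
      have := fracPart_conc_of_forall_ne (K := K) (w := [l']) (by simpa using hw.1)
        (by simpa using h1 l hl)
      rw [conc_cons, conc_nil, add_zero] at this
      rw [this, zero_add]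

lemma sort_eq_map_fst {w : List (Layer P)} (hw : Increasing w) {s : Finset ℝ}
    (hs : ∀ g, g ∈ s ↔ ∃ l ∈ w, (l.1 : ℝ) = g) :
    s.sort (· ≤ ·) = w.map fun l => (l.1 : ℝ) := by
  have hlt : (w.map fun l => (l.1 : ℝ)).Pairwise (· < ·) :=
    List.pairwise_map.2 (hw.imp fun h => by exact_mod_cast h)
  have hnd : (w.map fun l => (l.1 : ℝ)).Nodup := hlt.imp fun h => h.ne
  have : s = (w.map fun l => (l.1 : ℝ)).toFinset := by
    ext g
    rw [hs, List.mem_toFinset, List.mem_map]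
  rw [this]
  exact (List.toFinset_sort (· ≤ ·) hnd).2 (hlt.imp fun h => h.le)

/-- The layers at nonzero positions must be nonempty because `fracs` only records fractional parts
that carry a token; `z` may be empty, as `zero` is always present. -/
lemma absMarking_conc {hs ls : List (Layer P)} (z : Multiset (P × ℕ)) (hhs : Increasing hs)
    (hls : Increasing ls) (hhs' : ∀ l ∈ hs, 1 / 2 < l.1 ∧ l.1 < 1)
    (hls' : ∀ l ∈ ls, 0 < l.1 ∧ l.1 < 1 / 2) (hhs0 : ∀ l ∈ hs, l.2 ≠ 0) (hls0 : ∀ l ∈ ls, l.2 ≠ 0) :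
    absMarking K (conc (hs ++ (0, z) :: ls)) = ⟨word K hs, cut K z, word K ls⟩ := by
  have half : (1 / 2 : ℝ≥0) < 1 := by
    rw [← NNReal.coe_lt_coe]; norm_num
  have hw : ∀ l ∈ hs ++ (0, z) :: ls, l.1 < 1 := by
    simp only [List.mem_append, List.mem_cons]
    rintro l (hl | rfl | hl)
    exacts [(hhs' l hl).2, one_pos, (hls' l hl).2.trans half]
  have hne : (hs ++ (0, z) :: ls).Pairwise fun l l' => l.1 ≠ l'.1 := by
    refine List.pairwise_append.2 ⟨List.Pairwise.imp (fun h => h.ne) hhs, List.pairwise_cons.2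
      ⟨fun l hl => (hls' l hl).1.ne, List.Pairwise.imp (fun h => h.ne) hls⟩, ?_⟩
    simp only [List.mem_cons]
    rintro l hl l' (rfl | hl')
    · exact (zero_le.trans_lt (hhs' l hl).1).ne'
    · exact ((hls' l' hl').2.trans (hhs' l hl).1).ne'
  have key : ∀ (w : List (Layer P)) (s : Finset ℝ), Increasing w →
      (∀ l ∈ w, l ∈ hs ++ (0, z) :: ls) → (∀ g, g ∈ s ↔ ∃ l ∈ w, (l.1 : ℝ) = g) →
      (s.sort (· ≤ ·)).map (fracPart K (conc (hs ++ (0, z) :: ls))) = word K w := by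
    intro w s hi hmem hs
    rw [sort_eq_map_fst hi hs, List.map_map]
    exact List.map_congr_left fun l hl => fracPart_conc hw hne (hmem l hl)
  have hhsR : ∀ l ∈ hs, (1 / 2 : ℝ) < l.1 := fun l hl => by
    have := NNReal.coe_lt_coe.2 (hhs' l hl).1
    simpa using this
  have hlsR : ∀ l ∈ ls, (0 : ℝ) < l.1 ∧ (l.1 : ℝ) < 1 / 2 := fun l hl => by
    have := NNReal.coe_lt_coe.2 (hls' l hl).2
    exact ⟨NNReal.coe_pos.2 (hls' l hl).1, by simpa using this⟩
  rw [absMarking]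
  congr 1
  · refine key hs _ hhs (fun l hl => by simp [hl]) fun g => ?_
    rw [Finset.mem_filter, mem_fracs_conc hw]
    constructor
    · rintro ⟨⟨l, hl, -, rfl⟩, hg⟩
      rcases List.mem_append.1 hl with hl | hl
      · exact ⟨l, hl, rfl⟩
      · exfalso
        rcases List.mem_cons.1 hl with rfl | hl
        · norm_num at hg
        · exact absurd (hlsR l hl).2 (not_lt.2 hg)
    · rintro ⟨l, hl, rfl⟩
      exact ⟨⟨l, by simp [hl], hhs0 l hl, rfl⟩, (hhsR l hl).le⟩
  · exact fracPart_conc hw hne (l := (0, z)) (by simp)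
  · refine key ls _ hls (fun l hl => by simp [hl]) fun g => ?_
    rw [Finset.mem_filter, mem_fracs_conc hw]
    constructor
    · rintro ⟨⟨l, hl, -, rfl⟩, hg⟩
      rcases List.mem_append.1 hl with hl | hl
      · exact absurd (hhsR l hl) (not_lt.2 hg.2.le)
      · rcases List.mem_cons.1 hl with rfl | hl
        · simp at hg
        · exact ⟨l, hl, rfl⟩
    · rintro ⟨l, hl, rfl⟩
      exact ⟨⟨l, by simp [hl], hls0 l hl, rfl⟩, hlsR l hl⟩

lemma AMarking.Reduced.exists_absMarking_eq {B : AMarking P K} (hB : B.Reduced) :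
    ∃ M : Marking P, InDeltaForm (2 / 5) M ∧ absMarking K M = B := by
  have h45 : (4 / 5 : ℝ≥0) < 1 := by rw [← NNReal.coe_lt_coe]; norm_num
  have h15 : (0 : ℝ≥0) < 1 / 5 := by rw [← NNReal.coe_lt_coe]; norm_num
  have h12 : (1 / 2 : ℝ≥0) < 4 / 5 := by rw [← NNReal.coe_lt_coe]; norm_num
  have h12' : (1 / 5 : ℝ≥0) < 1 / 2 := by rw [← NNReal.coe_lt_coe]; norm_num
  -- Extending the empty word places any word of multisets in a prescribed interval. Here `(4/5, 1)`
  -- and `(0, 1/5)` lie well inside the `2/5`-form and on the correct sides of `1/2`.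
  obtain ⟨hs, -, a1, a2, -, a4, -⟩ := exists_extension (K := K) (w := []) (c := B.high) h45
    List.Pairwise.nil (by simp) .nil
  obtain ⟨ls, -, b1, b2, -, b4, -⟩ := exists_extension (K := K) (w := []) (c := B.low) h15
    List.Pairwise.nil (by simp) .nil
  refine ⟨conc (hs ++ (0, lift B.zero) :: ls), ?_, ?_⟩
  · intro a ha
    obtain ⟨l, hl, c, -, rfl⟩ := mem_conc.1 ha
    simp only [List.mem_append, List.mem_cons] at hl
    rcases hl with hl | rfl | hl
    · right
      have := NNReal.coe_lt_coe.2 (a2 l hl).1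
      rw [fract_natCast_add_coe _ (a2 l hl).2]
      push_cast at this
      linarith
    · left
      rw [fract_natCast_add_coe _ one_pos]
      norm_num
    · left
      have := NNReal.coe_lt_coe.2 (b2 l hl).2
      rw [fract_natCast_add_coe _ ((b2 l hl).2.trans (h12'.trans (h12.trans h45)))]
      push_cast at this
      linarith
  · rw [absMarking_conc _ a1 b1 (fun l hl => ⟨h12.trans (a2 l hl).1, (a2 l hl).2⟩)
      (fun l hl => ⟨(b2 l hl).1, (b2 l hl).2.trans h12'⟩), a4, b4, cut_lift]
    · intro l hl h0
      exact hB.1 (cut K l.2) (a4 ▸ List.mem_map.2 ⟨l, hl, rfl⟩) (cut_eq_zero.2 h0)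
    · intro l hl h0
      exact hB.2 (cut K l.2) (b4 ▸ List.mem_map.2 ⟨l, hl, rfl⟩) (cut_eq_zero.2 h0)

lemma absMarking_zero : absMarking K (0 : Marking P) = ⟨[], 0, []⟩ := by
  simpa using absMarking_conc (K := K) (P := P) (hs := []) (ls := []) 0 List.Pairwise.nil
    List.Pairwise.nil (by simp) (by simp) (by simp) (by simp)

end Realization

/-! ## Simulation by the abstract net -/

lemma AMarking.Reduced.reduce_zero {P : Type*} {K : ℕ} {B : AMarking P K} (hB : B.Reduced) :
    (AMarking.mk B.high 0 (reduce [B.zero] ++ B.low)).Reduced := by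
  refine ⟨hB.1, ?_⟩
  simp only [List.mem_append, mem_reduce]
  rintro b (hb | hb)
  exacts [hb.2, hB.2 b hb]

namespace PTPN

variable {Q P : Type*} (N : PTPN Q P)

/-- A tick of the clock. Every low layer is at most `u`, so none passes an integer before the clock
does, and all become high layers for the new phase `0`; at most a last layer exactly at `u` becomes
integral together with the tick. Positivity of `u` guarantees `x < 1`. -/
lemma exists_comp_of_high_eq_nil (q : Q) {u x : ℝ≥0} {M : Marking P} {B : AMarking P N.cmax}
    (hu : 0 < u) (hx : 0 < x) (hux : u + x = 1) (hB : B.Reduced) (hh : B.high = [])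
    (hM : Rep N.cmax u u M B) :
    ∃ B' : AMarking P N.cmax, B'.Reduced ∧ Comp N.AStep (q, B) (N.storageCost M) (q, B') ∧
      Rep N.cmax 0 0 (delay x M) B' := by
  rw [← hM.storageCost_eq N]
  obtain ⟨hs, z, ls, rfl, rfl, -, hls, -, hls'⟩ := hM
  obtain rfl : hs = [] := by simpa [word] using hh
  have hx1 : x < 1 := by linarith
  have wrap : ∀ (l₁ : List (Layer P)) (b : Multiset (P × ℕ)), Increasing l₁ →
      (∀ l ∈ l₁, 0 < l.1 ∧ l.1 < u) →
      Rep N.cmax 0 0 (delay x (conc [] + place 0 z + (conc l₁ + place u b + conc [])))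
        ⟨reduce [cut N.cmax z] ++ word N.cmax l₁, succAge (cut N.cmax b), []⟩ :=
    fun l₁ b h1 h2 => by
    simpa using rep_delay_wrap (K := N.cmax) (u := 0) (v := 0) (hs := []) (l₂ := []) (z := z)
      (b := b)
      hux hx1 hx List.Pairwise.nil h1 List.Pairwise.nil (by simp) h2 (by simp)
  -- Type 4 applies if a layer ticks with the clock, type 3 otherwise, both with the cut at the end
  -- of the low word.
  by_cases hlast : ∃ l₁ b, ls = l₁ ++ [(u, b)]
  · obtain ⟨l₁, b, rfl⟩ := hlast
    obtain ⟨h1, -, h2⟩ := List.pairwise_append.1 hls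
    have hred := hB.reduce_zero.2
    simp only [word_append, ← List.append_assoc] at hred
    rw [word_append] at hB ⊢
    refine ⟨_, ⟨fun c hc => hred c (List.mem_append_left _ hc), by simp⟩,
      .single (.type4 q [] (word N.cmax l₁) [] _ (cut N.cmax b) hB), ?_⟩
    simpa using wrap l₁ b h1 fun l hl => ⟨(hls' l (by simp [hl])).1, h2 l hl (u, b) (by simp)⟩
  · have hlt : ∀ l ∈ ls, 0 < l.1 ∧ l.1 < u := by
      obtain rfl | ⟨l₁, ⟨f, b⟩, rfl⟩ := List.eq_nil_or_concat' ls
      · simp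
      have hf : f < u := (hls' (f, b) (by simp)).2.lt_of_ne fun h => hlast ⟨l₁, b, by rw [← h]⟩
      intro l hl
      refine ⟨(hls' l hl).1, ?_⟩
      rcases List.mem_append.1 hl with hl | hl
      · exact ((List.pairwise_append.1 hls).2.2 l hl (f, b) (by simp)).trans hf
      · rwa [List.mem_singleton.1 hl]
    have hstep := AStep.type3 (N := N) q [] (word N.cmax ls) [] (cut N.cmax z) (by simpa using hB)
    rw [List.append_nil] at hstep
    refine ⟨_, ⟨fun c hc => hB.reduce_zero.2 c (by simpa using hc), by simp⟩, .single hstep, ?_⟩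
    simpa [succAge_eq_zero.2 rfl] using wrap ls 0 hls hlt

/-- A delay up to the next tick at most. High layers lie beyond the phase, so they reach an integer
before the clock, one after the other starting with the last; each costs nothing abstractly. The
induction removes them in this order. -/
lemma exists_comp_of_delay_le (q : Q) {u x : ℝ≥0} {M : Marking P} {B : AMarking P N.cmax}
    (hx : 0 < x) (hux : u + x ≤ 1) (hB : B.Reduced) (hM : Rep N.cmax u u M B) :
    ∃ (B' : AMarking P N.cmax) (r u' : ℝ≥0), B'.Reduced ∧ Comp N.AStep (q, B) r (q, B') ∧
      Rep N.cmax u' u' (delay x M) B' ∧ (u + x < 1 → r = 0 ∧ u' = u + x) ∧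
      (u + x = 1 → r = N.storageCost M ∧ u' = 0) := by
  induction hn : B.high.length generalizing u x M B with
  | zero =>
    obtain ⟨hs, z, ls, rfl, rfl, hhs, hls, hhs', hls'⟩ := hM
    obtain rfl : hs = [] := by simpa [word] using hn
    rcases hux.lt_or_eq with hlt | heq
    · exact ⟨_, 0, u + x, hB.reduce_zero, .single (.type1 q _ hB),
        rep_delay hx hhs hls (by simp) hls', fun _ => ⟨rfl, rfl⟩, fun h => absurd h hlt.ne⟩
    · have hx2 : 0 < x / 2 := half_pos hx
      have hux2 : u + x / 2 + x / 2 = 1 := by rw [add_assoc, add_halves, heq]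
      obtain ⟨B', h1, h2, h3⟩ := N.exists_comp_of_high_eq_nil q (u := u + x / 2) (x := x / 2)
        (by positivity) hx2 hux2 hB.reduce_zero rfl (rep_delay hx2 hhs hls (by simp) hls')
      rw [delay_delay, add_halves] at h3
      rw [storageCost_delay] at h2
      exact ⟨B', _, 0, h1, by simpa using (Comp.single (AStep.type1 q _ hB)).trans h2, h3,
        fun h => absurd heq h.ne, fun _ => ⟨rfl, rfl⟩⟩
  | succ n ih =>
    obtain ⟨hs, z, ls, rfl, rfl, hhs, hls, hhs', hls'⟩ := hM
    obtain rfl | ⟨hs, ⟨f, b⟩, rfl⟩ := List.eq_nil_or_concat' hs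
    · simp at hn
    have hf := hhs' (f, b) (by simp)
    obtain ⟨hi, -, hlt⟩ := List.pairwise_append.1 hhs
    rcases lt_or_ge (f + x) 1 with hfx | hfx
    · have hux' : u + x < 1 := lt_trans (by gcongr; exact hf.1) hfx
      refine ⟨_, 0, u + x, hB.reduce_zero, .single (.type1 q _ hB),
        rep_delay hx hhs hls (fun l hl => ⟨(hhs' l hl).1, ?_⟩) hls', fun _ => ⟨rfl, rfl⟩,
        fun h => absurd h hux'.ne⟩
      refine lt_of_le_of_lt ?_ hfx
      gcongr
      rcases List.mem_append.1 hl with hl | hl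
      · exact (hlt l hl (f, b) (by simp)).le
      · rw [List.mem_singleton.1 hl]
    · have hy : 0 < 1 - f := tsub_pos_of_lt hf.2
      have hfy : f + (1 - f) = 1 := add_tsub_cancel_of_le hf.2.le
      obtain ⟨y, hyf⟩ : ∃ y, y = 1 - f := ⟨_, rfl⟩
      rw [← hyf] at hy hfy
      have hrep := rep_delay_of_add_eq_one (K := N.cmax) (z := z) (b := b) hy hfy hi hls
        (fun l hl => ⟨(hhs' l (by simp [hl])).1, hlt l hl (f, b) (by simp)⟩) hls'
      have hB₁ : (AMarking.mk (word N.cmax hs ++ [cut N.cmax b]) 0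
          (reduce [cut N.cmax z] ++ word N.cmax ls)).Reduced := by
        refine ⟨by simpa [word] using hB.1, ?_⟩
        exact hB.reduce_zero.2
      have hB₂ : (AMarking.mk (word N.cmax hs) (succAge (cut N.cmax b))
          (reduce [cut N.cmax z] ++ word N.cmax ls)).Reduced :=
        ⟨fun b hb => hB₁.1 b (by simp [hb]), hB₁.2⟩
      have hcomp : Comp N.AStep (q, ⟨word N.cmax (hs ++ [(f, b)]), cut N.cmax z, word N.cmax ls⟩) 0
          (q, ⟨word N.cmax hs, succAge (cut N.cmax b),
            reduce [cut N.cmax z] ++ word N.cmax ls⟩) := by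
        -- Type 2 needs an empty `zero`, so type 1 must clear it first.
        have h1 := AStep.type1 (N := N) q _ hB
        rw [word_append] at h1 ⊢
        simpa using (Comp.single h1).trans (.single (.type2 q _ _ _ hB₁))
      have hyx : y ≤ x := by linarith
      have huy : u + y < 1 := by linarith [hf.1]
      rcases hyx.eq_or_lt with rfl | hyx
      · exact ⟨_, 0, u + y, hB₂, hcomp, hrep, fun _ => ⟨rfl, rfl⟩, fun h => absurd h huy.ne⟩
      · have hxy : y + (x - y) = x := add_tsub_cancel_of_le hyx.le
        obtain ⟨B', r, u', h1, h2, h3, h4⟩ := ih (tsub_pos_of_lt hyx)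
          (by rwa [add_assoc, hxy]) hB₂ hrep (by simpa [word] using hn)
        rw [delay_delay, hxy] at h3
        rw [add_assoc, hxy, storageCost_delay] at h4
        exact ⟨B', r, u', h1, by simpa using hcomp.trans h2, h3, h4⟩

/-- The number `n` counts the ticks. After the first one the phase is `0`, from where the remaining
delay is `n + u'` for the smaller `n`. -/
lemma exists_comp_of_delay (q : Q) (n : ℕ) {u x u' : ℝ≥0} {M : Marking P} {B : AMarking P N.cmax}
    (hu : u < 1) (hu' : u' < 1) (hx : 0 < x) (hux : u + x = n + u') (hB : B.Reduced)
    (hM : Rep N.cmax u u M B) :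
    ∃ B' : AMarking P N.cmax, B'.Reduced ∧
      Comp N.AStep (q, B) (n * N.storageCost M) (q, B') ∧ Rep N.cmax u' u' (delay x M) B' := by
  induction n generalizing u x M B with
  | zero =>
    rw [Nat.cast_zero, zero_add] at hux
    obtain ⟨B', r, w, h1, h2, h3, h4, -⟩ := N.exists_comp_of_delay_le q hx
      (hux.trans_lt hu').le hB hM
    obtain ⟨rfl, rfl⟩ := h4 (hux.trans_lt hu')
    exact ⟨B', h1, by simpa using h2, hux ▸ h3⟩
  | succ n ih =>
    obtain ⟨y, hy⟩ : ∃ y, u + y = 1 := ⟨1 - u, add_tsub_cancel_of_le hu.le⟩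
    have hy0 : 0 < y := by linarith
    obtain ⟨B₁, r, w, h1, h2, h3, -, h4⟩ := N.exists_comp_of_delay_le q hy0 hy.le hB hM
    obtain ⟨rfl, rfl⟩ := h4 hy
    have hxy : y + (n + u') = x := by
      push_cast at hux
      linarith
    -- A remaining delay of zero is treated apart, since the induction hypothesis needs a positive
    -- one.
    rcases (zero_le (a := (n : ℝ≥0) + u')).eq_or_lt with h0 | h0
    · rw [← h0, add_zero] at hxy
      obtain ⟨hn, rfl⟩ := add_eq_zero.1 h0.symm
      exact ⟨B₁, h1, by simpa [hn] using h2, hxy ▸ h3⟩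
    · obtain ⟨B', i1, i2, i3⟩ := ih one_pos h0 (zero_add _) h1 h3
      rw [delay_delay, hxy] at i3
      refine ⟨B', i1, ?_, i3⟩
      have := h2.trans i2
      rw [storageCost_delay] at this
      convert this using 1
      push_cast; ring

end PTPN

/-! ## Averaging over the phase of the clock -/

/-- The integrand differs from `x` by `fract (ψ + x) - fract ψ`, whose integral over a period
vanishes. -/
lemma integral_floor_sub_floor (x : ℝ) :
    IntervalIntegrable (fun ψ : ℝ => ((⌊ψ + x⌋ : ℤ) : ℝ) - ⌊ψ⌋) MeasureTheory.volume 0 1 ∧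
      ∫ ψ in (0 : ℝ)..1, (((⌊ψ + x⌋ : ℤ) : ℝ) - ⌊ψ⌋) = x := by
  have hint : ∀ a b : ℝ, IntervalIntegrable (Int.fract : ℝ → ℝ) MeasureTheory.volume a b := by
    intro a b
    have : (Int.fract : ℝ → ℝ) = fun y => y - ((⌊y⌋ : ℤ) : ℝ) := rfl
    rw [this]
    refine continuous_id.intervalIntegrable a b |>.sub ?_
    exact Monotone.intervalIntegrable fun y z h => by exact_mod_cast Int.floor_mono h
  have hint' : IntervalIntegrable (fun ψ : ℝ => Int.fract (ψ + x)) MeasureTheory.volume 0 1 := by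
    simpa using (hint (0 + x) (1 + x)).comp_add_right x
  have heq : (fun ψ : ℝ => ((⌊ψ + x⌋ : ℤ) : ℝ) - ⌊ψ⌋) =
      fun ψ => x - (Int.fract (ψ + x) - Int.fract ψ) := by
    ext ψ
    unfold Int.fract
    ring
  have hconst : IntervalIntegrable (fun _ : ℝ => x) MeasureTheory.volume 0 1 :=
    intervalIntegrable_const
  rw [heq]
  refine ⟨hconst.sub (hint'.sub (hint 0 1)), ?_⟩
  rw [intervalIntegral.integral_sub hconst (hint'.sub (hint 0 1)),
    intervalIntegral.integral_sub hint' (hint 0 1),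
    intervalIntegral.integral_comp_add_right (fun y => Int.fract y) x]
  have hper := (Int.fract_periodic ℝ).intervalIntegral_add_eq x 0
  rw [zero_add x, add_comm 1 x, hper]
  simp

namespace PTPN

variable {Q P : Type*} (N : PTPN Q P)

/-- A computation of the net gives, for every phase `u` of an integral clock, a computation of the
abstract net that pays for a unit of time whenever the clock ticks; the average of its costs is the
cost of the given computation. -/
lemma exists_abstract_comp {c c' : Q × Marking P} {r : ℝ≥0} (h : Comp N.Step c r c') :
    ∃ F : ℝ → ℝ, Function.Periodic F 1 ∧
      (∀ a b, IntervalIntegrable F MeasureTheory.volume a b) ∧ ∫ ψ in (0 : ℝ)..1, F ψ = r ∧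
      ∀ u : ℝ≥0, u < 1 → ∀ B, B.Reduced → Rep N.cmax u u c.2 B →
        ∃ (B' : AMarking P N.cmax) (s : ℝ≥0), B'.Reduced ∧ (s : ℝ) = F u ∧
          Comp N.AStep (c.1, B) s (c'.1, B') := by
  induction h with
  | refl c =>
    exact ⟨fun _ => 0, fun _ => rfl, fun a b => intervalIntegrable_const, by simp,
      fun u _ B hB _ => ⟨B, 0, hB, rfl, .refl _⟩⟩
  | cons h _ ih =>
    obtain ⟨F, hper, hint, hF, hsim⟩ := ih
    cases h with
    | time q M x hx =>
      obtain ⟨hfl, hflx⟩ := integral_floor_sub_floor x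
      set G : ℝ → ℝ := fun ψ => ((⌊ψ + x⌋ : ℤ) : ℝ) - ⌊ψ⌋ with hG
      have hGper : Function.Periodic G 1 := by
        intro ψ
        simp only [hG]
        rw [add_right_comm, Int.floor_add_one, Int.floor_add_one]
        push_cast; ring
      have hGint : ∀ a b, IntervalIntegrable G MeasureTheory.volume a b :=
        hGper.intervalIntegrable (t := 0) one_ne_zero (by simpa using hfl)
      have hFx : ∀ a b, IntervalIntegrable (fun ψ => F (ψ + x)) MeasureTheory.volume a b := by
        intro a b
        simpa using (hint (a + x) (b + x)).comp_add_right x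
      -- `G` counts the ticks during the delay, and the rest of the computation starts at phase `ψ +
      -- x`. Periodicity of `F` makes this shift invisible to the mean and allows the phase to be
      -- reduced modulo one.
      refine ⟨fun ψ => G ψ * N.storageCost M + F (ψ + x), ?_,
        fun a b => ((hGint a b).mul_const _).add (hFx a b), ?_, ?_⟩
      · intro ψ
        simp only
        rw [hGper, add_right_comm, hper]
      · rw [intervalIntegral.integral_add ((hGint 0 1).mul_const _) (hFx 0 1),
          intervalIntegral.integral_mul_const, hflx, intervalIntegral.integral_comp_add_right,
          zero_add, add_comm 1 (x : ℝ), hper.intervalIntegral_add_eq x 0, zero_add, hF]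
        push_cast; rfl
      · intro u hu B hB hM
        obtain ⟨n, u', hu', hn⟩ : ∃ (n : ℕ) (u' : ℝ≥0), u' < 1 ∧ u + x = n + u' := by
          refine ⟨⌊u + x⌋₊, u + x - ⌊u + x⌋₊, ?_,
            (add_tsub_cancel_of_le (Nat.floor_le zero_le)).symm⟩
          rw [tsub_lt_iff_left (Nat.floor_le zero_le)]
          exact Nat.lt_floor_add_one _
        obtain ⟨B₁, h1, h2, h3⟩ := N.exists_comp_of_delay q n hu hu' hx hn hB hM
        obtain ⟨B', s, i1, i2, i3⟩ := hsim u' hu' B₁ h1 h3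
        refine ⟨B', _, i1, ?_, h2.trans i3⟩
        have hnR : (u : ℝ) + x = n + u' := by exact_mod_cast hn
        have hu'R : (u' : ℝ) < 1 := by exact_mod_cast hu'
        have huR : (u : ℝ) < 1 := by exact_mod_cast hu
        have f1 : ⌊(u' : ℝ)⌋ = 0 := Int.floor_eq_zero_iff.2 ⟨u'.2, hu'R⟩
        have f2 : ⌊(u : ℝ)⌋ = 0 := Int.floor_eq_zero_iff.2 ⟨u.2, huR⟩
        have hFu : F ((n : ℝ) + u') = F u' := by
          rw [add_comm]
          simpa using hper.nat_mul n u'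
        simp only [hG, hnR, Int.floor_natCast_add, f1, f2, hFu]
        push_cast
        rw [i2]
        ring
    | disc t I R O rest hI hR hO =>
      refine ⟨fun ψ => N.transCost t + F ψ, fun ψ => by simp only [hper ψ],
        fun a b => intervalIntegrable_const.add (hint a b), ?_, ?_⟩
      · rw [intervalIntegral.integral_add intervalIntegrable_const (hint 0 1), hF]
        simp
      · intro u hu B hB hM
        obtain ⟨B₁, h1, h2, h3⟩ := exists_aFire (fun a ha => N.maxBound_le_cmax t.2 ha)
          hu hM hI hR hO
        obtain ⟨B', s, i1, i2, i3⟩ := hsim u hu B₁ h2 h3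
        exact ⟨B', _, i1, by push_cast; rw [i2], .cons (.disc t B B₁ h1) i3⟩

lemma rep_empty (K : ℕ) (u v : ℝ≥0) : Rep K u v (0 : Marking P) ⟨[], 0, []⟩ :=
  ⟨[], 0, [], by simp, by simp, .nil, .nil, by simp, by simp⟩

lemma exists_abstract_comp_le {q : Q} {c' : Q × Marking P} {r : ℝ≥0}
    (h : Comp N.Step (q, 0) r c') :
    ∃ (B' : AMarking P N.cmax) (s : ℝ≥0), B'.Reduced ∧ s ≤ r ∧
      Comp N.AStep (q, ⟨[], 0, []⟩) s (c'.1, B') := by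
  obtain ⟨F, -, hint, hF, hsim⟩ := N.exists_abstract_comp h
  -- If `F` exceeded its mean `r` on all of `[0, 1)`, then `F - r` would have a positive integral.
  obtain ⟨ψ, h0, h1, hψ⟩ : ∃ ψ : ℝ, 0 ≤ ψ ∧ ψ < 1 ∧ F ψ ≤ r := by
    by_contra! hcon
    have hi : IntervalIntegrable (fun _ : ℝ => (r : ℝ)) MeasureTheory.volume 0 1 :=
      intervalIntegrable_const
    have := intervalIntegral.intervalIntegral_pos_of_pos_on ((hint 0 1).sub hi)
      (fun ψ hψ => sub_pos.2 (hcon ψ hψ.1.le hψ.2)) one_pos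
    rw [intervalIntegral.integral_sub (hint 0 1) hi, hF] at this
    simp at this
  lift ψ to ℝ≥0 using h0
  obtain ⟨B', s, hB', hs, hcomp⟩ :=
    hsim ψ (by exact_mod_cast h1) ⟨[], 0, []⟩ ⟨by simp, by simp⟩ (rep_empty _ _ _)
  exact ⟨B', s, hB', by rw [← hs] at hψ; exact_mod_cast hψ, hcomp⟩

end PTPN

end PTPNCost

end

/-! ### The two inequalities between the infima -/

theorem mainTheorem3 {Q P : Type*} [Finite Q] [Finite P] (N : PTPNCost.PTPN Q P)
    (qinit qfin : Q) :
    PTPNCost.optCost N.Step {PTPNCost.initConf P qinit} (PTPNCost.finConfs P qfin) =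
      PTPNCost.optCost N.AStep (N.aptpnSet {PTPNCost.initConf P qinit})
        (N.aptpnSet (PTPNCost.finConfs P qfin)) := by
  refine le_antisymm (le_sInf ?_) (le_sInf ?_)
  · rintro _ ⟨_, ⟨c₀, ⟨rfl, -⟩, rfl⟩, _, ⟨c, ⟨hc, -⟩, rfl⟩, r, h, rfl⟩
    -- The simulation by the net only approximates the abstract cost, so an arbitrary excess `ε` is
    -- allowed.
    refine ENNReal.le_of_forall_pos_le_add fun ε hε _ => ?_
    obtain ⟨d, hd, hsim⟩ := N.exists_comp_of_abstract h hε
    obtain ⟨M, s, hs, hcomp⟩ := hsim d hd le_rfl 0 (by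
      change PTPNCost.Rep _ _ _ _ (PTPNCost.absMarking _ 0)
      rw [PTPNCost.absMarking_zero]
      exact PTPNCost.PTPN.rep_empty _ _ _)
    refine le_trans (sInf_le ⟨_, rfl, (c.1, M), hc, s, hcomp, rfl⟩) ?_
    exact_mod_cast hs
  · rintro _ ⟨_, rfl, c, hc, r, h, rfl⟩
    obtain ⟨B, s, hB, hs, hcomp⟩ := N.exists_abstract_comp_le h
    obtain ⟨M, hM, rfl⟩ := hB.exists_absMarking_eq
    refine le_trans (sInf_le ⟨_, ⟨_, ⟨rfl, ?_⟩, rfl⟩, _, ⟨(c.1, M), ⟨hc, hM⟩, rfl⟩, s, ?_, rfl⟩)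
      (ENNReal.coe_le_coe.2 hs)
    · intro a ha
      exact absurd ha (Multiset.notMem_zero a)
    · change PTPNCost.Comp _ (qinit, PTPNCost.absMarking _ 0) s _
      rw [PTPNCost.absMarking_zero]
      exact hcomp
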